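/- Consider $n\ge 1$ agents and $m$ resources, where agent $a$ has utility $u_a(r)\in\{0,1\}$ for resource $r$ and additive utility $u_a(B)=\sum_{r\in B}u_a(r)$ for a set $B$ of resources. An allocation $\pi$ assigns to each agent $a$ a set $\pi(a)$ of resources, sets of distinct agents being disjoint (not all resources need be allocated). It is envy-free if $u_a(\pi(a'))\le u_a(\pi(a))$ for all agents $a,a'$, and its egalitarian welfare is $\min_a u_a(\pi(a))$. Given the utilities and an integer threshold $t\ge 0$, the question is whether there is an envy-free allocation with egalitarian welfare at least $t$. There is a random access machine program (unit cost per operation; the numbers $n,m,t$ are given in registers and the matrix $(u_a(r))$ in memory) and a constant $C$ such that for all $n\ge 1$, $m$, $t$ and all $0/1$ utilities, the program decides this question in at most $C\cdot\max(1,m)^{2.5}$ steps; that is, the problem is solvable in $O(m^{2.5})$ time, where the constant depends on neither $n$ nor $t$. Moreover, such an allocation exists if and only if the bipartite graph whose one side consists of $t$ copies of each agent and whose other side consists of the resources, a copy of $a$ being adjacent to $r$ exactly when $u_a(r)=1$, has a matching that saturates the agent side. -/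

import Mathlib

/-! ### Allocations of indivisible resources -/

namespace FairDivision

variable {A R : Type*}

/-- Additive utility of agent `a` for the set `B` of resources. -/
def bundleUtility (u : A → R → ℕ) (a : A) (B : Finset R) : ℕ :=
  ∑ r ∈ B, u a r

/-- A (possibly partial) allocation: the bundles of distinct agents are disjoint. -/
def IsAllocation (π : A → Finset R) : Prop :=
  ∀ a a' : A, a ≠ a' → Disjoint (π a) (π a')

/-- No agent prefers the bundle of another agent to their own. -/
def EnvyFree (u : A → R → ℕ) (π : A → Finset R) : Prop :=
  ¬ ∃ a a' : A, bundleUtility u a (π a) < bundleUtility u a (π a')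

/-- Egalitarian social welfare: the minimum of the agents' utilities for their own bundles. -/
def esw [Fintype A] [Nonempty A] (u : A → R → ℕ) (π : A → Finset R) : ℕ :=
  Finset.univ.inf' Finset.univ_nonempty fun a => bundleUtility u a (π a)

/-- Every utility value is `0` or `1`. -/
def IsBinary (u : A → R → ℕ) : Prop :=
  ∀ a r, u a r = 0 ∨ u a r = 1

/-- The question: is there an envy-free allocation with egalitarian welfare at least `t`? -/
def HasEnvyFreeESW [Fintype A] [Nonempty A] (u : A → R → ℕ) (t : ℕ) : Prop :=
  ∃ π : A → Finset R, IsAllocation π ∧ EnvyFree u π ∧ t ≤ esw u π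

/-- The bipartite graph with `t` copies of each agent on one side and the resources on the other;
a copy of an agent is adjacent to the resources that the agent likes. -/
def copyGraph (u : A → R → ℕ) (t : ℕ) : SimpleGraph ((A × Fin t) ⊕ R) where
  Adj
    | Sum.inl x, Sum.inr r => u x.1 r = 1
    | Sum.inr r, Sum.inl x => u x.1 r = 1
    | _, _ => False
  symm := ⟨by rintro (x | r) (y | r') h <;> exact h⟩
  loopless := ⟨by rintro (x | r) h <;> exact h⟩

/-- The graph has a matching that covers every vertex of the agent side. -/
def HasAgentSaturatingMatching (u : A → R → ℕ) (t : ℕ) : Prop :=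
  ∃ M : (copyGraph u t).Subgraph, M.IsMatching ∧ ∀ x : A × Fin t, Sum.inl x ∈ M.verts

end FairDivision

/-! ### A random access machine with a step count

Programs are finite structured programs over natural-number registers and doubly indexed arrays
with indirect addressing. The only arithmetic operations are successor and (truncated)
predecessor, so that the numbers occurring in a run exceed the input numbers by at most the number
of steps made plus a constant of the program: charging one unit per operation is legitimate. -/

namespace RAM

/-- A memory state: registers, and arrays `arr k` with entries `arr k i j`. -/
structure State where
  reg : ℕ → ℕ
  arr : ℕ → ℕ → ℕ → ℕ

/-- Arithmetic expressions. Register names and array names are literals of the program;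
array indices are computed. -/
inductive Expr where
  | const (k : ℕ)
  | reg (x : ℕ)
  | succ (e : Expr)
  | pred (e : Expr)
  | get (k : ℕ) (i j : Expr)

/-- Value of an expression. -/
def Expr.eval (s : State) : Expr → ℕ
  | .const k => k
  | .reg x => s.reg x
  | .succ e => e.eval s + 1
  | .pred e => e.eval s - 1
  | .get k i j => s.arr k (i.eval s) (j.eval s)

/-- Cost of evaluating an expression: one unit per operation. -/
def Expr.cost : Expr → ℕ
  | .const _ => 1
  | .reg _ => 1
  | .succ e => e.cost + 1
  | .pred e => e.cost + 1
  | .get _ i j => i.cost + j.cost + 1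

/-- Tests. -/
inductive Test where
  | lt (e f : Expr)
  | eq (e f : Expr)
  | neg (b : Test)
  | conj (b c : Test)

/-- Truth of a test. -/
def Test.Holds (s : State) : Test → Prop
  | .lt e f => e.eval s < f.eval s
  | .eq e f => e.eval s = f.eval s
  | .neg b => ¬ b.Holds s
  | .conj b c => b.Holds s ∧ c.Holds s

/-- Cost of a test: one unit per operation. -/
def Test.cost : Test → ℕ
  | .lt e f => e.cost + f.cost + 1
  | .eq e f => e.cost + f.cost + 1
  | .neg b => b.cost + 1
  | .conj b c => b.cost + c.cost + 1

/-- Programs. -/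
inductive Program where
  | skip
  | assign (x : ℕ) (e : Expr)
  | set (k : ℕ) (i j e : Expr)
  | seq (p q : Program)
  | ite (b : Test) (p q : Program)
  | loop (b : Test) (p : Program)

/-- The state after writing `v` into register `x`. -/
def State.setReg (s : State) (x v : ℕ) : State :=
  { s with reg := fun y => if y = x then v else s.reg y }

/-- The state after writing `v` into the entry `(i, j)` of array `k`. -/
def State.setArr (s : State) (k i j v : ℕ) : State :=
  { s with arr := fun k' i' j' => if k' = k ∧ i' = i ∧ j' = j then v else s.arr k' i' j' }

/-- `Exec p s s' c`: started in state `s`, the program `p` halts in state `s'` after `c` steps.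
The constructor `loop b p` of programs is "while `b` do `p`". -/
inductive Exec : Program → State → State → ℕ → Prop
  | skip (s : State) : Exec .skip s s 1
  | assign (x : ℕ) (e : Expr) (s : State) :
      Exec (.assign x e) s (s.setReg x (e.eval s)) (e.cost + 1)
  | set (k : ℕ) (i j e : Expr) (s : State) :
      Exec (.set k i j e) s (s.setArr k (i.eval s) (j.eval s) (e.eval s))
        (i.cost + j.cost + e.cost + 1)
  | seq {p q : Program} {s s' s'' : State} {c d : ℕ} :
      Exec p s s' c → Exec q s' s'' d → Exec (.seq p q) s s'' (c + d)
  | ite_true {b : Test} {p q : Program} {s s' : State} {c : ℕ} :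
      b.Holds s → Exec p s s' c → Exec (.ite b p q) s s' (b.cost + c + 1)
  | ite_false {b : Test} {p q : Program} {s s' : State} {c : ℕ} :
      ¬ b.Holds s → Exec q s s' c → Exec (.ite b p q) s s' (b.cost + c + 1)
  | loop_done {b : Test} {p : Program} {s : State} :
      ¬ b.Holds s → Exec (.loop b p) s s (b.cost + 1)
  | loop_step {b : Test} {p : Program} {s s' s'' : State} {c d : ℕ} :
      b.Holds s → Exec p s s' c → Exec (.loop b p) s' s'' d →
        Exec (.loop b p) s s'' (b.cost + c + d + 1)

/-- The machine is deterministic: final state and number of steps are unique. -/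
theorem Exec.unique {p : Program} {s s₁ s₂ : State} {c₁ c₂ : ℕ}
    (h₁ : Exec p s s₁ c₁) (h₂ : Exec p s s₂ c₂) : s₁ = s₂ ∧ c₁ = c₂ := by
  induction h₁ generalizing s₂ c₂ with
  | skip => cases h₂; exact ⟨rfl, rfl⟩
  | assign => cases h₂; exact ⟨rfl, rfl⟩
  | set => cases h₂; exact ⟨rfl, rfl⟩
  | seq _ _ ih ih' =>
    cases h₂ with
    | seq h h' =>
      obtain ⟨rfl, rfl⟩ := ih h
      obtain ⟨rfl, rfl⟩ := ih' h'
      exact ⟨rfl, rfl⟩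
  | ite_true hb _ ih =>
    cases h₂ with
    | ite_true _ h => obtain ⟨rfl, rfl⟩ := ih h; exact ⟨rfl, rfl⟩
    | ite_false hb' => exact absurd hb hb'
  | ite_false hb _ ih =>
    cases h₂ with
    | ite_true hb' => exact absurd hb' hb
    | ite_false _ h => obtain ⟨rfl, rfl⟩ := ih h; exact ⟨rfl, rfl⟩
  | loop_done hb =>
    cases h₂ with
    | loop_done => exact ⟨rfl, rfl⟩
    | loop_step hb' => exact absurd hb' hb
  | loop_step hb _ _ ih ih' =>
    cases h₂ with
    | loop_done hb' => exact absurd hb hb'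
    | loop_step _ h h' =>
      obtain ⟨rfl, rfl⟩ := ih h
      obtain ⟨rfl, rfl⟩ := ih' h'
      exact ⟨rfl, rfl⟩

/-- The input: registers `0`, `1`, `2` hold the number `n` of agents, the number `m` of resources
and the threshold `t`; array `0` holds the utility matrix; everything else is zero. -/
def input {n m : ℕ} (u : Fin n → Fin m → ℕ) (t : ℕ) : State where
  reg x := if x = 0 then n else if x = 1 then m else if x = 2 then t else 0
  arr k i j := if h : k = 0 ∧ i < n ∧ j < m then u ⟨i, h.2.1⟩ ⟨j, h.2.2⟩ else 0

/-- Started in state `s`, the program `p` halts after at most `T` steps, and register `0` then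
holds `1` if `Q` is true and `0` if `Q` is false. -/
def Decides (p : Program) (s : State) (T : ℝ) (Q : Prop) : Prop :=
  ∃ (s' : State) (c : ℕ), Exec p s s' c ∧ (c : ℝ) ≤ T ∧
    ((Q ∧ s'.reg 0 = 1) ∨ (¬ Q ∧ s'.reg 0 = 0))

end RAM

/-!
Since utilities are `0` or `1`, an envy-free allocation of egalitarian welfare at least `t` exists
if and only if the `t` copies of every agent can be matched to distinct liked resources: cutting
every bundle down to `t` liked resources removes all envy. With more than `m` copies the answer is
no, so at most `m` copies need to be matched, in time `O(m ^ 2 * √m)`.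

The copies first take part in an auction with price cap `K`, where `K` is about `√(2 * m)`. A copy
takes a cheapest resource that it likes from its owner and raises the price by `1`, and a copy all
of whose liked resources have price `K` withdraws. There are `O(m * K)` steps of cost `O(m)`. If the
copies can be matched, then, by Hall's condition, for every `1 ≤ j ≤ K` the number of resources of
price at least `j` exceeds that of price at least `j + 1` by at least the number of withdrawn
copies. Hence at most `m / K ≤ K` copies withdraw, and each of these is matched by a search for an
augmenting path, of cost `O(m ^ 2)`.
-/

namespace FairDivision

variable {A R : Type*} {u : A → R → ℕ} {t : ℕ}

/-- The copies of the agents can be assigned distinct resources that their agents like: a matching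
saturating the agent side of `copyGraph u t`, given as a function. -/
def HasCopyAssignment (u : A → R → ℕ) (t : ℕ) : Prop :=
  ∃ f : A × Fin t → R, Function.Injective f ∧ ∀ x, u x.1 (f x) = 1

theorem HasCopyAssignment.card_mul_le [Fintype A] [Fintype R] (h : HasCopyAssignment u t) :
    Fintype.card A * t ≤ Fintype.card R := by
  obtain ⟨f, hf, -⟩ := h
  simpa only [Fintype.card_prod, Fintype.card_fin] using Fintype.card_le_of_injective f hf

theorem hasCopyAssignment_zero (u : A → R → ℕ) : HasCopyAssignment u 0 :=
  ⟨fun x => x.2.elim0, fun x => x.2.elim0, fun x => x.2.elim0⟩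

theorem bundleUtility_eq_card (hu : IsBinary u) (a : A) (B : Finset R) :
    bundleUtility u a B = (B.filter fun r => u a r = 1).card := by
  rw [bundleUtility, Finset.card_filter]
  refine Finset.sum_congr rfl fun r _ => ?_
  obtain h | h := hu a r <;> simp [h]

theorem HasEnvyFreeESW.hasCopyAssignment [Fintype A] [Nonempty A] (hu : IsBinary u)
    (h : HasEnvyFreeESW u t) : HasCopyAssignment u t := by
  obtain ⟨π, hπ, -, ht⟩ := h
  have liked_in_bundle : ∀ a, ∃ g : Fin t → R, Function.Injective g ∧
      ∀ i, g i ∈ π a ∧ u a (g i) = 1 := fun a => by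
    have card_le : Fintype.card (Fin t) ≤ Fintype.card ((π a).filter fun r => u a r = 1) := by
      rw [Fintype.card_fin, Fintype.card_coe, ← bundleUtility_eq_card hu]
      exact ht.trans (Finset.inf'_le _ (Finset.mem_univ a))
    obtain ⟨e⟩ := Function.Embedding.nonempty_of_card_le card_le
    exact ⟨fun i => e i, Subtype.val_injective.comp e.injective,
      fun i => Finset.mem_filter.1 (e i).2⟩
  choose g hg hgu using liked_in_bundle
  refine ⟨fun x => g x.1 x.2, ?_, fun x => (hgu x.1 x.2).2⟩
  rintro ⟨a, i⟩ ⟨b, j⟩ (e : g a i = g b j)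
  obtain rfl | hab := eq_or_ne a b
  · rw [hg a e]
  · exact absurd (e ▸ (hgu b j).1) (Finset.disjoint_left.1 (hπ a b hab) (hgu a i).1)

theorem HasCopyAssignment.hasEnvyFreeESW [Fintype A] [Nonempty A] (hu : IsBinary u)
    (h : HasCopyAssignment u t) : HasEnvyFreeESW u t := by
  classical
  obtain ⟨f, hf, hfu⟩ := h
  let π : A → Finset R := fun a => Finset.univ.image fun i => f (a, i)
  have card_bundle : ∀ a, (π a).card = t := fun a => by
    refine (Finset.card_image_of_injective _ (hf.comp (Prod.mk_right_injective a))).trans ?_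
    rw [Finset.card_univ, Fintype.card_fin]
  have utility_own : ∀ a, bundleUtility u a (π a) = t := fun a => by
    rw [bundleUtility_eq_card hu, Finset.filter_true_of_mem, card_bundle]
    simpa only [π, Finset.forall_mem_image] using fun i _ => hfu (a, i)
  refine ⟨π, fun a b hab => ?_, ?_, Finset.le_inf' _ _ fun a _ => (utility_own a).ge⟩
  · simp only [π, Finset.disjoint_left, Finset.mem_image, Finset.mem_univ, true_and]
    rintro _ ⟨i, rfl⟩ ⟨j, e⟩
    exact hab (congrArg Prod.fst (hf e)).symm
  · rintro ⟨a, b, h⟩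
    rw [utility_own, bundleUtility_eq_card hu] at h
    exact absurd ((Finset.card_filter_le _ _).trans (card_bundle b).le) (not_le.2 h)

theorem hasEnvyFreeESW_iff_hasCopyAssignment [Fintype A] [Nonempty A] (hu : IsBinary u) :
    HasEnvyFreeESW u t ↔ HasCopyAssignment u t :=
  ⟨HasEnvyFreeESW.hasCopyAssignment hu, HasCopyAssignment.hasEnvyFreeESW hu⟩

theorem hasAgentSaturatingMatching_iff_hasCopyAssignment :
    HasAgentSaturatingMatching u t ↔ HasCopyAssignment u t := by
  constructor
  · rintro ⟨M, hM, hs⟩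
    have partner : ∀ x : A × Fin t, ∃ r : R, M.Adj (.inl x) (.inr r) := fun x => by
      obtain ⟨y | r, hw, -⟩ := hM (hs x)
      · exact (M.adj_sub hw).elim
      · exact ⟨r, hw⟩
    choose f hf using partner
    refine ⟨f, fun x y e => ?_, fun x => M.adj_sub (hf x)⟩
    exact Sum.inl.inj (hM.eq_of_adj_right (hf x) (e ▸ hf y))
  · rintro ⟨f, hf, hfu⟩
    let agentSide : Set ((A × Fin t) ⊕ R) := Set.range Sum.inl
    let partners : Set ((A × Fin t) ⊕ R) := Set.range (Sum.inr ∘ f)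
    let e : agentSide ≃ partners := (Equiv.ofInjective _ Sum.inl_injective).symm.trans
      (Equiv.ofInjective _ (Sum.inr_injective.comp hf))
    have disjoint : Disjoint agentSide partners := by
      simp [agentSide, partners, Set.disjoint_left]
    have adj : ∀ v : agentSide, (copyGraph u t).Adj v (e v) := by
      rintro ⟨_, x, rfl⟩
      rw [Equiv.trans_apply, Equiv.ofInjective_symm_apply]
      exact hfu x
    obtain ⟨M, hverts, hM⟩ := SimpleGraph.Subgraph.IsMatching.exists_of_disjoint_sets_of_equiv
      disjoint e adj
    exact ⟨M, hM, fun x => hverts ▸ .inl ⟨x, rfl⟩⟩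

end FairDivision

namespace BipartiteMatching

variable {L R : Type*} {adj : L → R → Prop} {X : Finset L} {Y : Finset R}

/-- The bipartite graph `adj` has a matching into `Y` that covers every vertex of `X`. -/
def Saturable (adj : L → R → Prop) (X : Finset L) (Y : Finset R) : Prop :=
  ∃ f : X → Y, Function.Injective f ∧ ∀ x : X, adj x (f x)

theorem Saturable.card_le_card (h : Saturable adj X Y) {Z : Finset L} {T : Finset R}
    (hZ : Z ⊆ X) (hT : ∀ x ∈ Z, ∀ r ∈ Y, adj x r → r ∈ T) : Z.card ≤ T.card := by
  obtain ⟨f, hinj, hf⟩ := h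
  let g : Z → T := fun x : Z => ⟨f ⟨x, hZ x.2⟩, hT x x.2 _ (f _).2 (hf ⟨x, hZ x.2⟩)⟩
  have g_inj : Function.Injective g := fun x y e => by
    have e' : f ⟨x, hZ x.2⟩ = f ⟨y, hZ y.2⟩ := Subtype.ext (Subtype.mk.inj e)
    exact Subtype.ext (Subtype.mk.inj (hinj e'))
  simpa only [Fintype.card_coe] using Fintype.card_le_of_injective g g_inj

theorem saturable_Icc_range_iff {adj : ℕ → ℕ → Prop} {N m : ℕ} :
    Saturable adj (Finset.Icc 1 N) (Finset.range m) ↔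
      ∃ f : Fin N → Fin m, Function.Injective f ∧ ∀ i : Fin N, adj (i + 1) (f i) := by
  let e : Finset.Icc 1 N ≃ Fin N :=
    { toFun := fun x : Finset.Icc 1 N => ⟨x - 1, by have := Finset.mem_Icc.1 x.2; omega⟩
      invFun := fun i => ⟨i + 1, by rw [Finset.mem_Icc]; omega⟩
      left_inv := fun x => Subtype.ext (Nat.sub_add_cancel (Finset.mem_Icc.1 x.2).1)
      right_inv := fun _ => rfl }
  let e' : Finset.range m ≃ Fin m :=
    (Equiv.subtypeEquivRight fun _ => Finset.mem_range).trans Fin.equivSubtype.symm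
  refine ((e.arrowCongr e').exists_congr_left).trans (exists_congr fun f => and_congr ?_ ?_)
  · exact (EquivLike.comp_injective _ e'.symm).trans (EquivLike.injective_comp e f)
  · exact e.forall_congr_left

section Partial

variable [Zero L] {own : R → L} {W : List L} {cur : L}

/-- A matching in progress. It is stored as the function `own` that maps a vertex of `Y` to its
partner, or to `0` if it is free. The vertices of `X` not yet covered are those of the list `W` and
the current vertex `cur`, where `cur = 0` means that there is no current vertex. -/
structure IsPartial (adj : L → R → Prop) (X : Finset L) (Y : Finset R) (own : R → L) (W : List L)
    (cur : L) : Prop where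
  adj_own : ∀ r ∈ Y, own r ≠ 0 → adj (own r) r
  own_inj : ∀ r ∈ Y, ∀ r' ∈ Y, own r ≠ 0 → own r = own r' → r = r'
  own_notMem : ∀ r ∈ Y, own r ≠ 0 → own r ∉ cur :: W
  mem_iff : ∀ x, x ∈ X ↔ x ≠ 0 ∧ (x ∈ cur :: W ∨ ∃ r ∈ Y, own r = x)
  nodup : (cur :: W).Nodup
  zero_notMem : 0 ∉ W

namespace IsPartial

theorem empty (adj : L → R → Prop) (hown : ∀ r ∈ Y, own r = 0) :
    IsPartial adj ∅ Y own [] 0 := by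
  constructor <;> grind

theorem open_insert [DecidableEq L] (h : IsPartial adj X Y own W 0) {x : L} (hx : x ∉ X)
    (h0 : x ≠ 0) : IsPartial adj (insert x X) Y own W x := by
  obtain ⟨h1, h2, h3, h4, h5, h6⟩ := h
  constructor <;> grind

theorem update [DecidableEq R] (h : IsPartial adj X Y own W cur) (hc : cur ≠ 0) {b : R}
    (hb : b ∈ Y) (ha : adj cur b) :
    IsPartial adj X Y (Function.update own b cur) W (own b) := by
  obtain ⟨h1, h2, h3, h4, h5, h6⟩ := h
  constructor <;> grind [Function.update_apply]

theorem postpone (h : IsPartial adj X Y own W cur) (hc : cur ≠ 0) :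
    IsPartial adj X Y own (W ++ [cur]) 0 := by
  obtain ⟨h1, h2, h3, h4, h5, h6⟩ := h
  constructor <;> grind

theorem resume {x : L} (h : IsPartial adj X Y own (W ++ [x]) 0) :
    IsPartial adj X Y own W x := by
  obtain ⟨h1, h2, h3, h4, h5, h6⟩ := h
  constructor <;> grind

theorem saturable (h : IsPartial adj X Y own [] 0) : Saturable adj X Y := by
  have partner : ∀ x : X, ∃ r : Y, own r = x := fun x : X => by
    obtain ⟨h0, hx | ⟨r, hr, e⟩⟩ := (h.mem_iff x).1 x.2
    · exact absurd (List.mem_singleton.1 hx) h0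
    · exact ⟨⟨r, hr⟩, e⟩
  choose f hf using partner
  refine ⟨f, fun x y e => Subtype.ext ?_, fun x : X => ?_⟩
  · rw [← hf x, e, hf y]
  · have h0 : own (f x) ≠ 0 := hf x ▸ ((h.mem_iff x).1 x.2).1
    simpa only [hf x] using h.adj_own (f x) (f x).2 h0

theorem card_add_card_le (h : IsPartial adj X Y own W cur) (hs : Saturable adj X Y)
    {T T' : Finset R} {U : Finset L} (hT : T ⊆ Y) (hown : ∀ r ∈ T, own r ≠ 0)
    (hU : ∀ x ∈ U, x ≠ 0 ∧ x ∈ cur :: W)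
    (hadj_own : ∀ r ∈ T, ∀ r' ∈ Y, adj (own r) r' → r' ∈ T')
    (hadj : ∀ x ∈ U, ∀ r ∈ Y, adj x r → r ∈ T') : T.card + U.card ≤ T'.card := by
  classical
  have card_image : (T.image own).card = T.card := Finset.card_image_of_injOn
    fun r hr r' hr' e => h.own_inj r (hT hr) r' (hT hr') (hown r hr) e
  have disjoint : Disjoint (T.image own) U := by
    rw [Finset.disjoint_left, Finset.forall_mem_image]
    exact fun r hr hrU => h.own_notMem r (hT hr) (hown r hr) (hU _ hrU).2
  rw [← card_image, ← Finset.card_union_of_disjoint disjoint]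
  refine hs.card_le_card (fun x hx => (h.mem_iff x).2 ?_) fun x hx => ?_
  · obtain hx | hx := Finset.mem_union.1 hx
    · obtain ⟨r, hr, rfl⟩ := Finset.mem_image.1 hx
      exact ⟨hown r hr, .inr ⟨r, hT hr, rfl⟩⟩
    · exact ⟨(hU x hx).1, .inl (hU x hx).2⟩
  · obtain hx | hx := Finset.mem_union.1 hx
    · obtain ⟨r, hr, rfl⟩ := Finset.mem_image.1 hx
      exact hadj_own r hr
    · exact hadj x hx

end IsPartial

end Partial

/-- The vertices of `Y` whose label is at least `j`: the vertices of price at least `j` during the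
auction, the visited vertices during a search. -/
def superlevel (Y : Finset R) (label : R → ℕ) (j : ℕ) : Finset R :=
  Y.filter fun r => j ≤ label r

theorem mem_superlevel {label : R → ℕ} {j : ℕ} {r : R} :
    r ∈ superlevel Y label j ↔ r ∈ Y ∧ j ≤ label r :=
  Finset.mem_filter

theorem superlevel_eq_empty {label : R → ℕ} {j : ℕ} (h : ∀ r ∈ Y, label r < j) :
    superlevel Y label j = ∅ :=
  Finset.filter_eq_empty_iff.2 fun r hr => not_le.2 (h r hr)

theorem superlevel_update [DecidableEq R] {label : R → ℕ} {b : R} {j : ℕ} (hb : b ∈ Y) :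
    superlevel Y (Function.update label b j) j = insert b (superlevel Y label j) := by
  ext r
  rw [Finset.mem_insert, mem_superlevel, mem_superlevel, Function.update_apply]
  grind

section Auction

variable [Zero L] {K : ℕ} {own : R → L} {price : R → ℕ} {W : List L} {cur : L}

/-- The invariant of an auction with price cap `K`: a vertex of `Y` is matched as soon as it has a
positive price, its partner would save at most `1` by choosing another neighbour, and the postponed
vertices `W` have neighbours of price at least `K` only. -/
structure IsAuction (adj : L → R → Prop) (X : Finset L) (Y : Finset R) (K : ℕ) (own : R → L)
    (price : R → ℕ) (W : List L) (cur : L) : Prop extends IsPartial adj X Y own W cur where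
  price_le : ∀ r ∈ Y, price r ≤ K
  price_eq_zero : ∀ r ∈ Y, own r = 0 → price r = 0
  slack : ∀ r ∈ Y, own r ≠ 0 → ∀ r' ∈ Y, adj (own r) r' → price r ≤ price r' + 1
  exhausted : ∀ x ∈ W, ∀ r ∈ Y, adj x r → K ≤ price r

namespace IsAuction

theorem empty (adj : L → R → Prop) (K : ℕ) (hown : ∀ r ∈ Y, own r = 0)
    (hprice : ∀ r ∈ Y, price r = 0) : IsAuction adj ∅ Y K own price [] 0 where
  toIsPartial := .empty adj hown
  price_le r hr := hprice r hr ▸ Nat.zero_le K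
  price_eq_zero r hr _ := hprice r hr
  slack r hr h0 := absurd (hown r hr) h0
  exhausted _ hx := absurd hx List.not_mem_nil

theorem open_insert [DecidableEq L] (h : IsAuction adj X Y K own price W 0) {x : L} (hx : x ∉ X)
    (h0 : x ≠ 0) : IsAuction adj (insert x X) Y K own price W x where
  __ := h
  toIsPartial := h.toIsPartial.open_insert hx h0

theorem bid [DecidableEq R] (h : IsAuction adj X Y K own price W cur) (hc : cur ≠ 0) {b : R}
    (hb : b ∈ Y) (ha : adj cur b) (hK : price b < K)
    (hmin : ∀ r ∈ Y, adj cur r → price b ≤ price r) :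
    IsAuction adj X Y K (Function.update own b cur) (Function.update price b (price b + 1)) W
      (own b) := by
  obtain ⟨h0, h1, h2, h3, h4⟩ := h
  refine ⟨h0.update hc hb ha, ?_, ?_, ?_, ?_⟩ <;> grind [Function.update_apply]

theorem postpone (h : IsAuction adj X Y K own price W cur) (hc : cur ≠ 0)
    (hK : ∀ r ∈ Y, adj cur r → K ≤ price r) : IsAuction adj X Y K own price (W ++ [cur]) 0 where
  __ := h
  toIsPartial := h.toIsPartial.postpone hc
  exhausted := by
    have := h.exhausted
    grind

theorem card_superlevel_add_length_le (h : IsAuction adj X Y K own price W cur)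
    (hs : Saturable adj X Y) {j : ℕ} (hj : j < K) :
    (superlevel Y price (j + 2)).card + W.length ≤ (superlevel Y price (j + 1)).card := by
  classical
  have own_ne_zero : ∀ r ∈ superlevel Y price (j + 2), own r ≠ 0 := fun r hr h0 => by
    have := mem_superlevel.1 hr
    have := h.price_eq_zero r this.1 h0
    omega
  rw [← List.toFinset_card_of_nodup (List.nodup_cons.1 h.nodup).2]
  refine h.card_add_card_le hs (Finset.filter_subset _ _) own_ne_zero ?_ ?_ ?_
  · intro x hx
    rw [List.mem_toFinset] at hx
    exact ⟨fun h0 => h.zero_notMem (h0 ▸ hx), List.mem_cons_of_mem _ hx⟩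
  · intro r hr r' hr' ha
    have slack := h.slack r (mem_superlevel.1 hr).1 (own_ne_zero r hr) r' hr' ha
    rw [mem_superlevel] at hr ⊢
    exact ⟨hr', by omega⟩
  · intro x hx r hr ha
    exact mem_superlevel.2 ⟨hr, hj.trans_le (h.exhausted x (List.mem_toFinset.1 hx) r hr ha)⟩

theorem length_mul_le (h : IsAuction adj X Y K own price W cur) (hs : Saturable adj X Y) :
    W.length * K ≤ Y.card := by
  have telescope : ∀ j ≤ K, (superlevel Y price (j + 1)).card + W.length * j ≤ Y.card := by
    intro j
    induction j with
    | zero => exact fun _ => Finset.card_filter_le _ _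
    | succ j ih =>
      intro hj
      have := ih (by omega)
      have : (superlevel Y price (j + 1 + 1)).card + W.length ≤ (superlevel Y price (j + 1)).card :=
        h.card_superlevel_add_length_le hs hj
      rw [Nat.mul_succ]
      omega
  exact (Nat.le_add_left _ _).trans (telescope K le_rfl)

end IsAuction

theorem sum_sub_update_lt [DecidableEq R] {b : R} (hb : b ∈ Y) (hK : price b < K) :
    ∑ r ∈ Y, (K - Function.update price b (price b + 1) r) < ∑ r ∈ Y, (K - price r) := by
  refine Finset.sum_lt_sum (fun r _ => ?_) ⟨b, hb, ?_⟩
  · obtain rfl | hr := eq_or_ne r b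
    · rw [Function.update_self]
      omega
    · rw [Function.update_of_ne hr]
  · rw [Function.update_self]
    omega

end Auction

section Search

variable {own own' : R → L} {prev prev' : L → R} {root x : L} {S : List R}

/-- The vertices of `S` lead back from `x` to `root` along an alternating path: `prev` points to
the vertex of `Y` by which the search came, whose new partner comes next on the path. -/
def IsTrail (adj : L → R → Prop) (own : R → L) (prev : L → R) (root : L) : L → List R → Prop
  | x, [] => x = root
  | x, r :: S => prev x = r ∧ adj x r ∧ IsTrail adj own prev root (own r) S

namespace IsTrail

theorem root_owns (h : IsTrail adj own prev root x S) : S = [] ∨ ∃ r ∈ S, own r = root := by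
  induction S generalizing x with
  | nil => exact .inl rfl
  | cons r S ih =>
    right
    obtain rfl | ⟨r', hr', e⟩ := ih h.2.2
    · exact ⟨r, List.mem_cons_self, h.2.2⟩
    · exact ⟨r', List.mem_cons_of_mem r hr', e⟩

theorem congr (h : IsTrail adj own prev root x S) (hown : ∀ r ∈ S, own' r = own r)
    (hx : prev' x = prev x) (hprev : ∀ r ∈ S, prev' (own r) = prev (own r)) :
    IsTrail adj own' prev' root x S := by
  induction S generalizing x with
  | nil => exact h
  | cons r S ih =>
    rw [List.forall_mem_cons] at hown hprev
    exact ⟨hx.trans h.1, h.2.1, hown.1.symm ▸ ih h.2.2 hown.2 hprev.1 hprev.2⟩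

end IsTrail

variable [Zero L] {V : Finset R} {W : List L} {cur : L}

/-- The invariant of a depth-first search for an augmenting path from `root`: all vertices of the
set `V` of visited vertices are matched, and those not on the trail `S` are done with. -/
structure IsSearch (adj : L → R → Prop) (X : Finset L) (Y : Finset R) (own : R → L) (prev : L → R)
    (V : Finset R) (W : List L) (cur root : L) (S : List R) : Prop
    extends IsPartial adj X Y own W cur where
  trail : IsTrail adj own prev root cur S
  nodup_trail : S.Nodup
  trail_subset : ∀ r ∈ S, r ∈ V
  visited_subset : V ⊆ Y
  own_ne_zero : ∀ r ∈ V, own r ≠ 0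
  closed : ∀ r ∈ V, r ∈ S ∨ ∀ r' ∈ Y, adj (own r) r' → r' ∈ V

namespace IsSearch

theorem start (h : IsPartial adj X Y own W root) : IsSearch adj X Y own prev ∅ W root root [] where
  toIsPartial := h
  trail := rfl
  nodup_trail := List.nodup_nil
  trail_subset _ hr := absurd hr List.not_mem_nil
  visited_subset := Finset.empty_subset Y
  own_ne_zero _ hr := absurd hr (Finset.notMem_empty _)
  closed _ hr := absurd hr (Finset.notMem_empty _)

theorem forward [DecidableEq L] [DecidableEq R] (h : IsSearch adj X Y own prev V W cur root S)
    (hc : cur ≠ 0) {b : R} (hb : b ∈ Y) (hbV : b ∉ V) (ha : adj cur b) (h0 : own b ≠ 0) :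
    IsSearch adj X Y (Function.update own b cur) (Function.update prev (own b) b) (insert b V) W
      (own b) root (b :: S) := by
  have hbS : b ∉ S := fun hbS => hbV (h.trail_subset b hbS)
  have own_b_ne : cur ≠ own b := fun e => h.own_notMem b hb h0 (e ▸ List.mem_cons_self)
  obtain ⟨h, trail, h1, h2, h3, h4, h5⟩ := h
  refine ⟨h.update hc hb ha, ⟨Function.update_self .., h.adj_own b hb h0, ?_⟩,
    List.nodup_cons.2 ⟨hbS, h1⟩, ?_, ?_, ?_, ?_⟩
  · rw [Function.update_self]
    refine trail.congr (fun r hr => Function.update_of_ne (fun e : r = b => hbS (e ▸ hr)) ..)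
      (Function.update_of_ne own_b_ne ..) fun r hr => Function.update_of_ne (fun e => hbS ?_) ..
    rwa [h.own_inj b hb r (h3 (h2 r hr)) h0 e.symm]
  all_goals grind [Function.update_apply]

theorem partial_of_free [DecidableEq R] (h : IsSearch adj X Y own prev V W cur root S)
    (hc : cur ≠ 0) {b : R} (hb : b ∈ Y) (ha : adj cur b) (h0 : own b = 0) :
    IsPartial adj X Y (Function.update own b cur) W 0 :=
  h0 ▸ h.toIsPartial.update hc hb ha

theorem trail_eq_nil (h : IsSearch adj X Y own prev V W root root S) : S = [] := by
  refine h.trail.root_owns.resolve_right ?_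
  rintro ⟨r, hr, rfl⟩
  have hrV := h.trail_subset r hr
  exact h.own_notMem r (h.visited_subset hrV) (h.own_ne_zero r hrV) List.mem_cons_self

theorem backtrack [DecidableEq R] (h : IsSearch adj X Y own prev V W cur root S) (hc : cur ≠ 0)
    (hroot : cur ≠ root) (hV : ∀ r ∈ Y, adj cur r → r ∈ V) :
    ∃ S', S = prev cur :: S' ∧
      IsSearch adj X Y (Function.update own (prev cur) cur) prev V W (own (prev cur)) root S' := by
  obtain _ | ⟨r, S'⟩ := S
  · exact absurd h.trail hroot
  obtain ⟨h, ⟨rfl, ha, trail⟩, h1, h2, h3, h4, h5⟩ := h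
  have notMem := (List.nodup_cons.1 h1).1
  refine ⟨S', rfl, h.update hc (h3 (h2 _ List.mem_cons_self)) ha, ?_, (List.nodup_cons.1 h1).2,
    fun r hr => h2 r (List.mem_cons_of_mem _ hr), h3, ?_, ?_⟩
  · refine trail.congr (fun r hr => Function.update_of_ne ?_ ..) rfl fun _ _ => rfl
    exact fun e : r = prev cur => notMem (e ▸ hr)
  all_goals grind [Function.update_apply]

theorem not_saturable (h : IsSearch adj X Y own prev V W root root S) (h0 : root ≠ 0)
    (hV : ∀ r ∈ Y, adj root r → r ∈ V) : ¬ Saturable adj X Y := by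
  classical
  intro hs
  have := h.card_add_card_le hs (T := V) (T' := V) (U := {root}) h.visited_subset h.own_ne_zero
    (fun x hx => by rw [Finset.mem_singleton.1 hx]; exact ⟨h0, List.mem_cons_self⟩)
    (fun r hr => (h.closed r hr).resolve_left (h.trail_eq_nil ▸ List.not_mem_nil))
    (fun x hx => by rwa [Finset.mem_singleton.1 hx])
  rw [Finset.card_singleton] at this
  omega

end IsSearch

end Search

end BipartiteMatching

namespace RAM

/-- Total correctness: started in `s`, the program `p` halts, and its final state and number of
steps satisfy `Q`. -/
def Yields (p : Program) (s : State) (Q : State → ℕ → Prop) : Prop :=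
  ∃ (s' : State) (c : ℕ), Exec p s s' c ∧ Q s' c

section Yields

variable {p q : Program} {b : Test} {s : State} {Q : State → ℕ → Prop}

theorem yields_assign {x : ℕ} {e : Expr} :
    Yields (.assign x e) s Q ↔ Q (s.setReg x (e.eval s)) (e.cost + 1) :=
  ⟨fun ⟨_, _, he, hq⟩ => by cases he; exact hq, fun h => ⟨_, _, .assign x e s, h⟩⟩

theorem yields_set {k : ℕ} {i j e : Expr} :
    Yields (.set k i j e) s Q ↔
      Q (s.setArr k (i.eval s) (j.eval s) (e.eval s)) (i.cost + j.cost + e.cost + 1) :=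
  ⟨fun ⟨_, _, he, hq⟩ => by cases he; exact hq, fun h => ⟨_, _, .set k i j e s, h⟩⟩

theorem yields_skip : Yields .skip s Q ↔ Q s 1 :=
  ⟨fun ⟨_, _, he, hq⟩ => by cases he; exact hq, fun h => ⟨_, _, .skip s, h⟩⟩

theorem yields_seq :
    Yields (.seq p q) s Q ↔ Yields p s fun s' c => Yields q s' fun s'' d => Q s'' (c + d) := by
  constructor
  · rintro ⟨s', c, he, hq⟩
    cases he with
    | seq h h' => exact ⟨_, _, h, _, _, h', hq⟩
  · rintro ⟨_, _, h, _, _, h', hq⟩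
    exact ⟨_, _, .seq h h', hq⟩

theorem yields_ite :
    Yields (.ite b p q) s Q ↔
      (b.Holds s → Yields p s fun s' c => Q s' (b.cost + c + 1)) ∧
      (¬ b.Holds s → Yields q s fun s' c => Q s' (b.cost + c + 1)) := by
  constructor
  · rintro ⟨s', c, he, hq⟩
    cases he with
    | ite_true hb h => exact ⟨fun _ => ⟨_, _, h, hq⟩, fun hb' => absurd hb hb'⟩
    | ite_false hb h => exact ⟨fun hb' => absurd hb' hb, fun _ => ⟨_, _, h, hq⟩⟩
  · rintro ⟨h₁, h₂⟩
    by_cases hb : b.Holds s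
    · obtain ⟨_, _, h, hq⟩ := h₁ hb
      exact ⟨_, _, .ite_true hb h, hq⟩
    · obtain ⟨_, _, h, hq⟩ := h₂ hb
      exact ⟨_, _, .ite_false hb h, hq⟩

end Yields

/-- The registers that a program may change. -/
def Program.assigned : Program → List ℕ
  | .skip | .set .. => []
  | .assign x _ => [x]
  | .seq p q | .ite _ p q => p.assigned ++ q.assigned
  | .loop _ p => p.assigned

/-- The arrays that a program may change. -/
def Program.written : Program → List ℕ
  | .skip | .assign .. => []
  | .set k .. => [k]
  | .seq p q | .ite _ p q => p.written ++ q.written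
  | .loop _ p => p.written

/-- The frame condition of a program `p` started in `s` and halting in `s'`: everything that `p`
does not mention as a target is unchanged. -/
structure Program.Frame (p : Program) (s s' : State) : Prop where
  reg : ∀ x ∉ p.assigned, s'.reg x = s.reg x
  arr : ∀ k ∉ p.written, s'.arr k = s.arr k

theorem Program.Frame.refl (p : Program) (s : State) : p.Frame s s :=
  ⟨fun _ _ => rfl, fun _ _ => rfl⟩

theorem Program.Frame.trans {p : Program} {s s' s'' : State} (h : p.Frame s s')
    (h' : p.Frame s' s'') : p.Frame s s'' :=
  ⟨fun x hx => (h'.reg x hx).trans (h.reg x hx), fun k hk => (h'.arr k hk).trans (h.arr k hk)⟩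

theorem Program.Frame.weaken {p q : Program} {s s' : State} (h : p.Frame s s')
    (hreg : p.assigned ⊆ q.assigned) (harr : p.written ⊆ q.written) : q.Frame s s' :=
  ⟨fun x hx => h.reg x (mt (@hreg x) hx), fun k hk => h.arr k (mt (@harr k) hk)⟩

theorem Exec.frame {p : Program} {s s' : State} {c : ℕ} (h : Exec p s s' c) : p.Frame s s' := by
  induction h with
  | skip s => exact .refl _ s
  | assign x e s =>
    exact ⟨fun y hy => if_neg (mt List.mem_singleton.2 hy), fun _ _ => rfl⟩
  | set k i j e s =>
    refine ⟨fun _ _ => rfl, fun k' hk => funext₂ fun i' j' => if_neg fun h => ?_⟩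
    exact hk (List.mem_singleton.2 h.1)
  | seq _ _ ih ih' =>
    exact (ih.weaken (List.subset_append_left ..) (List.subset_append_left ..)).trans
      (ih'.weaken (List.subset_append_right ..) (List.subset_append_right ..))
  | ite_true _ _ ih => exact ih.weaken (List.subset_append_left ..) (List.subset_append_left ..)
  | ite_false _ _ ih => exact ih.weaken (List.subset_append_right ..) (List.subset_append_right ..)
  | loop_done => exact .refl _ _
  | loop_step _ _ _ ih ih' => exact .trans ⟨ih.reg, ih.arr⟩ ih'

theorem Yields.imp {p : Program} {s : State} {Q Q' : State → ℕ → Prop} (h : Yields p s Q)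
    (hQ : ∀ s' c, p.Frame s s' → Q s' c → Q' s' c) : Yields p s Q' :=
  let ⟨s', c, he, hq⟩ := h
  ⟨s', c, he, hQ s' c he.frame hq⟩

/-- The number `k` in the invariant `I k` bounds the number of iterations to come. -/
theorem yields_loop {b : Test} {p : Program} (I : ℕ → State → Prop) (D : ℕ) {k : ℕ} {s : State}
    (h : I k s)
    (step : ∀ k s', p.Frame s s' → I k s' → b.Holds s' →
      Yields p s' fun s'' c => c ≤ D ∧ ∃ k' < k, I k' s'') :
    Yields (.loop b p) s fun s' c =>
      c ≤ k * (D + b.cost + 1) + b.cost + 1 ∧ ¬ b.Holds s' ∧ ∃ k', I k' s' := by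
  induction k using Nat.strong_induction_on generalizing s with
  | _ k ih =>
    by_cases hb : b.Holds s
    · obtain ⟨s', c, he, hc, k', hk, hI⟩ := step k s (.refl p s) h hb
      obtain ⟨s'', d, he', hd, hq⟩ :=
        ih k' hk hI fun k s'' hs => step k s'' (he.frame.trans hs)
      refine ⟨s'', _, .loop_step hb he he', ?_, hq⟩
      have : (k' + 1) * (D + b.cost + 1) ≤ k * (D + b.cost + 1) := Nat.mul_le_mul_right _ hk
      rw [Nat.add_mul] at this
      omega
    · exact ⟨s, _, .loop_done hb, by omega, hb, k, h⟩

theorem yields_loop_of_measure {b : Test} {p : Program} (I : State → Prop) (μ : State → ℕ) (D : ℕ)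
    {s : State} (h : I s)
    (step : ∀ s', p.Frame s s' → I s' → b.Holds s' →
      Yields p s' fun s'' c => c ≤ D ∧ I s'' ∧ μ s'' < μ s') :
    Yields (.loop b p) s fun s' c =>
      c ≤ μ s * (D + b.cost + 1) + b.cost + 1 ∧ ¬ b.Holds s' ∧ I s' := by
  refine (yields_loop (fun k s' => I s' ∧ μ s' = k) D ⟨h, rfl⟩ ?_).imp
    fun s' c _ ⟨hc, hb, _, hI, _⟩ => ⟨hc, hb, hI⟩
  rintro _ s' hs ⟨hI, rfl⟩ hb
  exact (step s' hs hI hb).imp fun s'' c _ ⟨hc, hI, hμ⟩ => ⟨hc, _, hμ, hI, rfl⟩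

/-- The registers of the program. The first three hold the input numbers; the result is returned
in the register `agents`, which has number `0`. -/
inductive Var where
  | agents | resources | threshold
  | copies | agent | copy
  | cap | rest | fill
  | bound | cur | res | best | bestLabel
  | opened | numWaiting | root | prevOwner | failed
  deriving DecidableEq

/-- The number of a register: its position in the list of registers. -/
def Var.idx (x : Var) : ℕ :=
  x.ctorIdx

/-- The arrays of the program, all but the utility matrix indexed by a single number: the agents of
the copies, the partners of the resources, their prices or marks, the resources by which a search
came to the copies, and the copies that withdrew from the auction. -/
inductive Table where
  | utility | agentOf | owner | label | prev | waiting
  deriving DecidableEq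

/-- The number of an array: its position in the list of arrays. -/
def Table.idx (k : Table) : ℕ :=
  k.ctorIdx

instance : Coe Var ℕ := ⟨Var.idx⟩

instance : Coe Table ℕ := ⟨Table.idx⟩

instance : Coe Var Expr := ⟨fun x => .reg x⟩

theorem Var.idx_inj {x y : Var} : x.idx = y.idx ↔ x = y :=
  ⟨fun h => by rw [← Var.ofNat_ctorIdx x, ← Var.ofNat_ctorIdx y]; exact congrArg _ h, congrArg _⟩

theorem Table.idx_inj {k l : Table} : k.idx = l.idx ↔ k = l :=
  ⟨fun h => by rw [← Table.ofNat_ctorIdx k, ← Table.ofNat_ctorIdx l]; exact congrArg _ h,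
    congrArg _⟩

/-- The function stored in a singly indexed array. -/
def State.tab (s : State) (k : Table) : ℕ → ℕ :=
  fun i => s.arr k i 0

/-- The expression reading the entry `i` of a singly indexed array. -/
def load (k : Table) (i : Expr) : Expr :=
  .get k i (.const 0)

/-- The command writing the entry `i` of a singly indexed array. -/
def store (k : Table) (i e : Expr) : Program :=
  .set k i (.const 0) e

/-- The state after writing `v` into the entry `i` of a singly indexed array. -/
def State.setTab (s : State) (k : Table) (i v : ℕ) : State :=
  s.setArr k i 0 v

theorem yields_store {k : Table} {i e : Expr} {s : State} {Q : State → ℕ → Prop} :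
    Yields (store k i e) s Q ↔
      Q (s.setTab k (i.eval s) (e.eval s)) (i.cost + 1 + e.cost + 1) :=
  yields_set

section Simp

variable (s : State) (x y : Var) (k l : Table) (i v : ℕ)

theorem eval_load (e : Expr) : (load k e).eval s = s.tab k (e.eval s) :=
  rfl

theorem cost_load (e : Expr) : (load k e).cost = e.cost + 2 :=
  rfl

theorem reg_setReg : (s.setReg x v).reg y = if y = x then v else s.reg y := by
  simp only [State.setReg, Var.idx_inj]

theorem tab_setReg : (s.setReg x v).tab k = s.tab k :=
  rfl

theorem reg_setTab : (s.setTab k i v).reg = s.reg :=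
  rfl

theorem tab_setTab :
    (s.setTab k i v).tab l = if l = k then Function.update (s.tab l) i v else s.tab l := by
  funext j
  split_ifs with h <;>
    simp only [State.tab, State.setTab, State.setArr, Table.idx_inj, h, Function.update_apply,
      true_and, and_true, false_and, if_false]

end Simp

section Frame

variable {p : Program} {s s' : State}

theorem Program.Frame.reg_eq (h : p.Frame s s') (x : Var)
    (hx : x.idx ∉ p.assigned := by decide) : s'.reg x = s.reg x :=
  h.reg x hx

theorem Program.Frame.arr_eq (h : p.Frame s s') (k : Table)
    (hk : k.idx ∉ p.written := by decide) : s'.arr k = s.arr k :=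
  h.arr k hk

theorem Program.Frame.tab_eq (h : p.Frame s s') (k : Table)
    (hk : k.idx ∉ p.written := by decide) : s'.tab k = s.tab k :=
  funext fun i => congrFun₂ (h.arr_eq k hk) i 0

end Frame

open Var Table BipartiteMatching

local notation:60 p:61 " ;; " q:60 => Program.seq p q

local notation:65 x:66 " ≔ " e:66 => Program.assign (Var.idx x) e

/-- Find a resource of least label among those with label below `bound` that the current copy
likes; `best = resources` if there is none. -/
def scan : Program :=
  res ≔ .const 0 ;; best ≔ resources ;; bestLabel ≔ bound ;;
  .loop (.lt res resources)
    (.ite (.conj (.eq (.get utility (load agentOf cur) res) (.const 1))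
        (.lt (load label res) bestLabel))
      (best ≔ res ;; bestLabel ≔ load label res) .skip ;;
    res ≔ .succ res)

/-- The current copy takes the best resource; the previous owner becomes the current copy. -/
def exchange : Program :=
  prevOwner ≔ load owner best ;; store owner best cur ;; cur ≔ prevOwner

/-- Copy `x` likes resource `r`, as stored in memory. -/
def Likes (s : State) (x r : ℕ) : Prop :=
  s.arr utility (s.tab agentOf x) r = 1

theorem Program.Frame.likes_eq {p : Program} {s s' : State} (h : p.Frame s s')
    (hu : utility.idx ∉ p.written := by decide) (ha : agentOf.idx ∉ p.written := by decide) :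
    Likes s' = Likes s := by
  funext x r
  simp only [Likes, h.arr_eq utility hu, h.tab_eq agentOf ha]

/-- The state of a search for a minimum after `n` of `m` candidates: `b < n` satisfies `P`, and
`v = f b < bound` is the least value of `f` on the candidates satisfying `P`. If they all have
values at least `bound`, then `b = m` and `v = bound`. -/
structure IsMinBelow (P : ℕ → Prop) (f : ℕ → ℕ) (bound m n b v : ℕ) : Prop where
  le : ∀ r < n, P r → v ≤ f r
  eq : (b < n ∧ P b ∧ v = f b ∧ v < bound) ∨ (b = m ∧ v = bound)

namespace IsMinBelow

variable {P : ℕ → Prop} {f : ℕ → ℕ} {bound m n b v : ℕ}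

theorem zero : IsMinBelow P f bound m 0 m bound :=
  ⟨fun _ hr => absurd hr (Nat.not_lt_zero _), .inr ⟨rfl, rfl⟩⟩

theorem replace (h : IsMinBelow P f bound m n b v) (hP : P n) (hf : f n < v) :
    IsMinBelow P f bound m (n + 1) n (f n) := by
  obtain ⟨le, eq⟩ := h
  constructor <;> grind

theorem keep (h : IsMinBelow P f bound m n b v) (hf : ¬ (P n ∧ f n < v)) :
    IsMinBelow P f bound m (n + 1) b v := by
  obtain ⟨le, eq⟩ := h
  constructor <;> grind

end IsMinBelow

/-- The scan up to `res` is recorded in `best` and `bestLabel`. -/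
def ScanInv (s : State) : Prop :=
  s.reg res ≤ s.reg resources ∧
    IsMinBelow (Likes s (s.reg cur)) (s.tab label) (s.reg bound) (s.reg resources) (s.reg res)
      (s.reg best) (s.reg bestLabel)

theorem scan_spec (s : State) :
    Yields scan s fun s' c => c ≤ 40 * s.reg resources + 20 ∧
      IsMinBelow (Likes s' (s'.reg cur)) (s'.tab label) (s'.reg bound) (s'.reg resources)
        (s'.reg resources) (s'.reg best) (s'.reg bestLabel) := by
  simp only [scan, yields_seq, yields_assign]
  refine (yields_loop_of_measure ScanInv (fun s => s.reg resources - s.reg res) 30 ?_ ?_).imp ?_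
  · simp only [ScanInv, Expr.eval, reg_setReg, tab_setReg, reduceCtorEq, if_true, if_false]
    exact ⟨Nat.zero_le _, .zero⟩
  · rintro s' - ⟨-, hmin⟩ hlt
    simp only [Test.Holds, Expr.eval] at hlt
    simp only [yields_seq, yields_ite, yields_assign, yields_skip, Test.Holds, Test.cost,
      Expr.eval, Expr.cost, eval_load, cost_load, reg_setReg, tab_setReg, ScanInv,
      reduceCtorEq, if_true, if_false]
    exact ⟨fun ⟨hl, hv⟩ => ⟨by omega, ⟨hlt, hmin.replace hl hv⟩, by omega⟩,
      fun hb => ⟨by omega, ⟨hlt, hmin.keep hb⟩, by omega⟩⟩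
  · rintro s' c - ⟨hc, hb, hle, hmin⟩
    simp only [Test.Holds, Expr.eval, not_lt] at hb
    rw [hle.antisymm hb] at hmin
    refine ⟨?_, hmin⟩
    simp only [Test.cost, Expr.cost, Expr.eval, reg_setReg, reduceCtorEq, if_true, if_false] at hc ⊢
    omega

/-- List the next copy. -/
def listCopy : Program :=
  copies ≔ .succ copies ;; store agentOf copies agent ;; copy ≔ .succ copy ;;
  .ite (.eq copy threshold) (agent ≔ .succ agent ;; copy ≔ .const 0) .skip

/-- List the copies of the agents, stopping when there are more of them than resources. -/
def listCopies : Program :=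
  copies ≔ .const 0 ;; agent ≔ .const 0 ;; copy ≔ .const 0 ;;
  .loop (.conj (.lt agent agents) (.lt copies (.succ resources))) listCopy

/-- Compute a price cap of the order of the square root of `resources`. -/
def computeCap : Program :=
  rest ≔ resources ;; cap ≔ .const 0 ;; fill ≔ .const 0 ;;
  .loop (.lt (.const 0) rest)
    (rest ≔ .pred rest ;; fill ≔ .succ fill ;;
    .ite (.eq fill (.succ cap)) (cap ≔ .succ cap ;; fill ≔ .const 0) .skip) ;;
  cap ≔ .succ cap

/-- The copies `1, …, copies` are listed agent by agent, each agent having `threshold`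
copies; `copy` copies of the current agent have been listed. -/
structure ListInv (s : State) : Prop where
  copies_eq : s.reg copies = s.reg agent * s.reg threshold + s.reg copy
  copy_lt : s.reg copy < s.reg threshold
  copies_le : s.reg copies ≤ s.reg agents * s.reg threshold
  copies_le_succ : s.reg copies ≤ s.reg resources + 1
  agentOf_eq : ∀ x ∈ Finset.Icc 1 (s.reg copies), s.tab agentOf x = (x - 1) / s.reg threshold

theorem listCopy_spec {s : State} (h : ListInv s) (hlt : s.reg agent < s.reg agents)
    (hlt' : s.reg copies < s.reg resources + 1) :
    Yields listCopy s fun s' c => c ≤ 30 ∧ ListInv s' ∧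
      s'.reg resources + 1 - s'.reg copies < s.reg resources + 1 - s.reg copies := by
  obtain ⟨hcopies, hcopy, hle, -, hagent⟩ := h
  have row : (s.reg agent + 1) * s.reg threshold ≤ s.reg agents * s.reg threshold :=
    Nat.mul_le_mul_right _ hlt
  have quotient : s.reg copies / s.reg threshold = s.reg agent :=
    Nat.div_eq_of_lt_le (by omega) (by rw [Nat.add_mul]; omega)
  have hagent' : ∀ x ∈ Finset.Icc 1 (s.reg copies + 1),
      Function.update (s.tab agentOf) (s.reg copies + 1) (s.reg agent) x =
        (x - 1) / s.reg threshold := by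
    grind [Function.update_apply]
  rw [Nat.add_mul] at row
  simp only [listCopy, yields_seq, yields_ite, yields_assign, yields_store, yields_skip,
    Test.Holds, Test.cost, Expr.eval, Expr.cost, reg_setReg, reg_setTab, reduceCtorEq, if_true,
    if_false]
  refine ⟨fun hfull => ⟨by omega, ?_, by omega⟩, fun hfull => ⟨by omega, ?_, by omega⟩⟩
  all_goals
    constructor <;>
      simp only [reg_setReg, tab_setReg, reg_setTab, tab_setTab, reduceCtorEq, if_true, if_false,
        Nat.add_mul]
    all_goals first | exact hagent' | omega

theorem listCopies_spec (s : State) (ht : 0 < s.reg threshold) :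
    Yields listCopies s fun s' c => c ≤ 40 * (s.reg resources + 2) ∧
      s'.reg copies = min (s.reg agents * s.reg threshold) (s.reg resources + 1) ∧
      ∀ x ∈ Finset.Icc 1 (s'.reg copies), s'.tab agentOf x = (x - 1) / s.reg threshold := by
  simp only [listCopies, yields_seq, yields_assign]
  refine (yields_loop_of_measure ListInv (fun s => s.reg resources + 1 - s.reg copies) 30
    ?_ ?_).imp ?_
  · constructor <;> simp [Expr.eval, reg_setReg, ht]
  · exact fun s' _ h hlt => listCopy_spec h hlt.1 hlt.2
  · rintro s' c hF ⟨hc, hb, hcopies, -, hle, hle', hagent⟩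
    have hn := hF.reg_eq agents
    have hm := hF.reg_eq resources
    have ht := hF.reg_eq threshold
    simp only [Test.Holds, Test.cost, Expr.cost, Expr.eval, reg_setReg, reduceCtorEq, if_true,
      if_false, not_and, not_lt] at hb hc hn hm ht ⊢
    rw [← hn, ← ht, ← hm]
    refine ⟨by omega, le_antisymm (le_min hle hle') ?_, hagent⟩
    by_contra! hlt
    have hagents : s'.reg agents * s'.reg threshold ≤ s'.reg agent * s'.reg threshold :=
      Nat.mul_le_mul_right _ (not_lt.1 fun h => by have := hb h; omega)
    omega

/-- The vertices of a triangle with rows of lengths `1, 2, …` are counted row by row: `cap` rows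
are full, the next row has `fill` vertices, and `rest` of the `resources` vertices remain. -/
def TriangleInv (s : State) : Prop :=
  2 * s.reg resources =
      s.reg cap * s.reg cap + s.reg cap + 2 * s.reg fill + 2 * s.reg rest ∧
    s.reg fill ≤ s.reg cap

theorem computeCap_spec (s : State) :
    Yields computeCap s fun s' c => c ≤ 40 * (s.reg resources + 1) ∧ 1 ≤ s'.reg cap ∧
      2 * s.reg resources ≤ s'.reg cap * s'.reg cap + s'.reg cap ∧
      s'.reg cap * s'.reg cap ≤ 2 * s.reg resources + s'.reg cap := by
  simp only [computeCap, yields_seq, yields_assign]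
  refine (yields_loop_of_measure TriangleInv (fun s => s.reg rest) 30 ?_ ?_).imp ?_
  · simp [TriangleInv, Expr.eval, reg_setReg]
  · rintro s' - ⟨hsum, hfill⟩ hlt
    simp only [Test.Holds, Expr.eval] at hlt
    simp only [yields_seq, yields_ite, yields_assign, yields_skip, Test.Holds, Test.cost,
      Expr.eval, Expr.cost, reg_setReg, TriangleInv, reduceCtorEq, if_true, if_false]
    refine ⟨fun hfull => ⟨by omega, ⟨?_, by omega⟩, by omega⟩,
      fun hfull => ⟨by omega, ⟨by omega, by omega⟩, by omega⟩⟩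
    have hsq : (s'.reg cap + 1) * (s'.reg cap + 1) =
        s'.reg cap * s'.reg cap + 2 * s'.reg cap + 1 := by ring
    omega
  · rintro s' c hF ⟨hc, hb, hsum, hfill⟩
    simp only [Test.Holds, Expr.eval, not_lt, nonpos_iff_eq_zero] at hb
    have hm := hF.reg_eq resources
    simp only [Test.cost, Expr.cost, Expr.eval, reg_setReg, reduceCtorEq, if_true,
      if_false] at hc hm ⊢
    rw [hm] at hsum
    exact ⟨by omega, by omega, by nlinarith, by nlinarith⟩

/-- The next copy enters the auction. -/
def openNext : Program :=
  opened ≔ .succ opened ;; cur ≔ opened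

/-- The current copy bids for the best resource. -/
def placeBid : Program :=
  store label best (.succ (load label best)) ;; exchange

/-- The current copy leaves the auction. -/
def withdraw : Program :=
  store waiting numWaiting cur ;; numWaiting ≔ .succ numWaiting ;; cur ≔ .const 0

/-- One step of the auction. -/
def auctionStep : Program :=
  .ite (.eq cur (.const 0)) openNext (scan ;; .ite (.lt best resources) placeBid withdraw)

/-- Let the copies bid for resources of price below the cap. -/
def auction : Program :=
  opened ≔ .const 0 ;; cur ≔ .const 0 ;; numWaiting ≔ .const 0 ;; bound ≔ cap ;;
  .loop (.neg (.conj (.eq opened copies) (.eq cur (.const 0)))) auctionStep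

/-- The stack of copies that have withdrawn from the auction and are still without a resource. -/
def State.waitingList (s : State) : List ℕ :=
  (List.range (s.reg numWaiting)).map (s.tab waiting)

theorem Program.Frame.waitingList_eq {p : Program} {s s' : State} (h : p.Frame s s')
    (hn : numWaiting.idx ∉ p.assigned := by decide) (hw : waiting.idx ∉ p.written := by decide) :
    s'.waitingList = s.waitingList := by
  rw [State.waitingList, State.waitingList, h.reg_eq numWaiting hn, h.tab_eq waiting hw]

theorem waitingList_eq_append {s s' : State} (hn : s'.reg numWaiting = s.reg numWaiting + 1)
    (hw : ∀ i < s.reg numWaiting, s'.tab waiting i = s.tab waiting i) :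
    s'.waitingList = s.waitingList ++ [s'.tab waiting (s.reg numWaiting)] := by
  rw [State.waitingList, State.waitingList, hn, List.range_succ, List.map_append,
    List.map_singleton]
  congr 1
  exact List.map_congr_left fun i hi => hw i (List.mem_range.1 hi)

/-- The memory holds an auction of the copies opened so far. -/
structure AuctionInv (s : State) : Prop where
  auction : IsAuction (Likes s) (Finset.Icc 1 (s.reg opened)) (Finset.range (s.reg resources))
    (s.reg cap) (s.tab owner) (s.tab label) s.waitingList (s.reg cur)
  opened_le : s.reg opened ≤ s.reg copies
  bound_eq : s.reg bound = s.reg cap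

/-- The potential of the auction: every step decreases it. -/
def auctionPotential (s : State) : ℕ :=
  ∑ r ∈ Finset.range (s.reg resources), (s.reg cap - s.tab label r) +
    2 * (s.reg copies - s.reg opened) + min (s.reg cur) 1

theorem exchange_spec (s : State) : Yields exchange s fun s' c =>
    c ≤ 10 ∧ s'.tab owner = Function.update (s.tab owner) (s.reg best) (s.reg cur) ∧
      s'.reg cur = s.tab owner (s.reg best) := by
  simp [exchange, yields_seq, yields_assign, yields_store, Expr.eval, Expr.cost, eval_load,
    cost_load, reg_setReg, tab_setReg, reg_setTab, tab_setTab]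

theorem openNext_spec {s : State} (h : AuctionInv s) (hcur : s.reg cur = 0)
    (hopen : s.reg opened ≠ s.reg copies) :
    Yields openNext s fun s' c =>
      c ≤ 20 ∧ AuctionInv s' ∧ auctionPotential s' < auctionPotential s := by
  have effect : Yields openNext s fun s' c =>
      c ≤ 20 ∧ s'.reg opened = s.reg opened + 1 ∧ s'.reg cur = s.reg opened + 1 := by
    simp [openNext, yields_seq, yields_assign, Expr.eval, Expr.cost, reg_setReg]
  refine effect.imp fun s' c hF ⟨hc, hopened', hcur'⟩ => ⟨hc, ?_, ?_⟩
  · obtain ⟨hA, hle, hbound⟩ := h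
    rw [hcur] at hA
    refine ⟨?_, ?_, ?_⟩
    · rw [hF.likes_eq, hF.reg_eq resources, hF.reg_eq cap, hF.tab_eq owner, hF.tab_eq label,
        hF.waitingList_eq, hopened', hcur', ← Finset.insert_Icc_right_eq_Icc_add_one (by omega)]
      exact hA.open_insert (by simp) (Nat.succ_ne_zero _)
    · rw [hopened', hF.reg_eq copies]
      omega
    · rw [hF.reg_eq bound, hF.reg_eq cap, hbound]
  · have := h.opened_le
    rw [auctionPotential, auctionPotential, hF.reg_eq resources, hF.reg_eq cap, hF.tab_eq label,
      hF.reg_eq copies, hopened', hcur', hcur]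
    omega

theorem placeBid_effect (s : State) :
    Yields placeBid s fun s' c => c ≤ 20 ∧
      s'.tab label =
        Function.update (s.tab label) (s.reg best) (s.tab label (s.reg best) + 1) ∧
      s'.tab owner = Function.update (s.tab owner) (s.reg best) (s.reg cur) ∧
      s'.reg cur = s.tab owner (s.reg best) := by
  rw [placeBid, yields_seq, yields_store]
  refine (exchange_spec _).imp fun s' c hF ⟨hc, howner, hcur'⟩ => ⟨?_, ?_, ?_, ?_⟩
  · simp only [Expr.cost, cost_load]
    omega
  · rw [hF.tab_eq label]
    simp [tab_setTab, Expr.eval, eval_load]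
  · simpa [tab_setTab, reg_setTab] using howner
  · simpa [tab_setTab, reg_setTab] using hcur'

theorem placeBid_spec {s : State} (h : AuctionInv s) (hcur : s.reg cur ≠ 0)
    (hbest : s.reg best < s.reg resources) (hlikes : Likes s (s.reg cur) (s.reg best))
    (hlt : s.tab label (s.reg best) < s.reg cap)
    (hmin : ∀ r < s.reg resources, Likes s (s.reg cur) r →
      s.tab label (s.reg best) ≤ s.tab label r) :
    Yields placeBid s fun s' c =>
      c ≤ 20 ∧ AuctionInv s' ∧ auctionPotential s' < auctionPotential s := by
  have hmem : s.reg best ∈ Finset.range (s.reg resources) := Finset.mem_range.2 hbest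
  refine (placeBid_effect s).imp fun s' c hF ⟨hc, hlabel', howner', hcur'⟩ => ⟨hc, ?_, ?_⟩
  · refine ⟨?_, ?_, ?_⟩
    · rw [hF.likes_eq, hF.reg_eq resources, hF.reg_eq cap, hlabel', howner',
        hF.waitingList_eq, hF.reg_eq opened, hcur']
      exact h.auction.bid hcur hmem hlikes hlt fun r hr => hmin r (Finset.mem_range.1 hr)
    · rw [hF.reg_eq opened, hF.reg_eq copies]
      exact h.opened_le
    · rw [hF.reg_eq bound, hF.reg_eq cap, h.bound_eq]
  · have decrease := sum_sub_update_lt hmem hlt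
    rw [auctionPotential, auctionPotential, hF.reg_eq resources, hF.reg_eq cap, hlabel',
      hF.reg_eq copies, hF.reg_eq opened]
    omega

theorem withdraw_spec {s : State} (h : AuctionInv s) (hcur : s.reg cur ≠ 0)
    (hmin : ∀ r < s.reg resources, Likes s (s.reg cur) r → s.reg cap ≤ s.tab label r) :
    Yields withdraw s fun s' c =>
      c ≤ 20 ∧ AuctionInv s' ∧ auctionPotential s' < auctionPotential s := by
  have effect : Yields withdraw s fun s' c => c ≤ 20 ∧
      s'.tab waiting = Function.update (s.tab waiting) (s.reg numWaiting) (s.reg cur) ∧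
      s'.reg numWaiting = s.reg numWaiting + 1 ∧ s'.reg cur = 0 := by
    simp [withdraw, yields_seq, yields_assign, yields_store, Expr.eval, Expr.cost, reg_setReg,
      tab_setReg, reg_setTab, tab_setTab]
  refine effect.imp fun s' c hF ⟨hc, hwaiting', hnum', hcur'⟩ => ⟨hc, ?_, ?_⟩
  · refine ⟨?_, ?_, ?_⟩
    · have push : s'.waitingList = s.waitingList ++ [s.reg cur] := by
        rw [waitingList_eq_append hnum', hwaiting', Function.update_self]
        exact fun i hi => hwaiting' ▸ Function.update_of_ne hi.ne ..
      rw [hF.likes_eq, hF.reg_eq resources, hF.reg_eq cap, hF.tab_eq owner, hF.tab_eq label, push,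
        hF.reg_eq opened, hcur']
      exact h.auction.postpone hcur fun r hr => hmin r (Finset.mem_range.1 hr)
    · rw [hF.reg_eq opened, hF.reg_eq copies]
      exact h.opened_le
    · rw [hF.reg_eq bound, hF.reg_eq cap, h.bound_eq]
  · rw [auctionPotential, auctionPotential, hF.reg_eq resources, hF.reg_eq cap, hF.tab_eq label,
      hF.reg_eq copies, hF.reg_eq opened, hcur']
    omega

theorem AuctionInv.of_frame_scan {s s' : State} (h : AuctionInv s) (hF : scan.Frame s s') :
    AuctionInv s' := by
  obtain ⟨hA, hle, hbound⟩ := h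
  refine ⟨?_, ?_, ?_⟩
  · rwa [hF.likes_eq, hF.reg_eq resources, hF.reg_eq cap, hF.tab_eq owner, hF.tab_eq label,
      hF.waitingList_eq, hF.reg_eq opened, hF.reg_eq cur]
  · rwa [hF.reg_eq opened, hF.reg_eq copies]
  · rwa [hF.reg_eq bound, hF.reg_eq cap]

theorem auctionPotential_eq_of_frame_scan {s s' : State} (hF : scan.Frame s s') :
    auctionPotential s' = auctionPotential s := by
  rw [auctionPotential, auctionPotential, hF.reg_eq resources, hF.reg_eq cap, hF.tab_eq label,
    hF.reg_eq copies, hF.reg_eq opened, hF.reg_eq cur]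

theorem auctionStep_spec {s : State} (h : AuctionInv s)
    (hrun : ¬ (s.reg opened = s.reg copies ∧ s.reg cur = 0)) :
    Yields auctionStep s fun s' c => c ≤ 40 * s.reg resources + 60 ∧
      AuctionInv s' ∧ auctionPotential s' < auctionPotential s := by
  simp only [auctionStep, yields_ite, yields_seq, Test.Holds, Test.cost, Expr.eval, Expr.cost]
  refine ⟨fun hcur => ?_, fun hcur => ?_⟩
  · exact (openNext_spec h hcur fun e => hrun ⟨e, hcur⟩).imp
      fun s' c _ ⟨hc, h'⟩ => ⟨by omega, h'⟩
  refine (scan_spec s).imp fun s' c hF ⟨hc, hmin⟩ => ?_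
  have h' := h.of_frame_scan hF
  rw [← auctionPotential_eq_of_frame_scan hF]
  rw [← hF.reg_eq cur] at hcur
  obtain ⟨hle, ⟨hbest, hlikes, hv, hlt⟩ | ⟨hbest, hv⟩⟩ := hmin
  · rw [hv] at hle hlt
    refine ⟨fun _ => ?_, fun hge => absurd hbest hge⟩
    exact (placeBid_spec h' hcur hbest hlikes (h'.bound_eq ▸ hlt) hle).imp
      fun s'' d _ ⟨hd, h''⟩ => ⟨by omega, h''⟩
  · rw [hv, h'.bound_eq] at hle
    refine ⟨fun hlt => absurd hbest hlt.ne, fun _ => ?_⟩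
    exact (withdraw_spec h' hcur hle).imp fun s'' d _ ⟨hd, h''⟩ => ⟨by omega, h''⟩

theorem auction_spec {s : State} (howner : ∀ r < s.reg resources, s.tab owner r = 0)
    (hlabel : ∀ r < s.reg resources, s.tab label r = 0) :
    Yields auction s fun s' c =>
      c ≤ (s.reg resources * s.reg cap + 2 * s.reg copies) * (40 * s.reg resources + 69) + 30 ∧
      IsAuction (Likes s') (Finset.Icc 1 (s'.reg copies)) (Finset.range (s'.reg resources))
        (s'.reg cap) (s'.tab owner) (s'.tab label) s'.waitingList 0 ∧
      s'.reg bound = s'.reg cap := by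
  simp only [auction, yields_seq, yields_assign]
  refine (yields_loop_of_measure AuctionInv auctionPotential (40 * s.reg resources + 60)
    ?_ ?_).imp ?_
  · constructor
    · simpa [State.waitingList, reg_setReg, Expr.eval, tab_setReg] using
        IsAuction.empty _ _ (fun r hr => howner r (Finset.mem_range.1 hr))
          fun r hr => hlabel r (Finset.mem_range.1 hr)
    · simp [reg_setReg, Expr.eval]
    · simp [reg_setReg, Expr.eval]
  · intro s' hF h hrun
    have hm := hF.reg_eq resources
    simp only [reg_setReg, Expr.eval, reduceCtorEq, if_false] at hm
    simpa only [hm] using auctionStep_spec h hrun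
  · rintro s' c - ⟨hc, hdone, hA, -, hbound⟩
    obtain ⟨hopened, hcur⟩ : s'.reg opened = s'.reg copies ∧ s'.reg cur = 0 := not_not.1 hdone
    rw [hopened, hcur] at hA
    refine ⟨?_, hA, hbound⟩
    simp only [auctionPotential, reg_setReg, tab_setReg, Expr.eval, Test.cost, Expr.cost,
      reduceCtorEq, if_true, if_false] at hc ⊢
    rw [Finset.sum_congr rfl fun r hr => by
      rw [hlabel r (Finset.mem_range.1 hr), Nat.sub_zero]] at hc
    simp only [Finset.sum_const, Finset.card_range, smul_eq_mul, Nat.sub_zero, Nat.zero_min,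
      Nat.add_zero, Nat.add_assoc, Nat.reduceAdd] at hc
    omega

/-- Resume a waiting copy; raising the bound turns all resources into unvisited ones. -/
def beginSearch : Program :=
  numWaiting ≔ .pred numWaiting ;; cur ≔ load waiting numWaiting ;; root ≔ cur ;;
  bound ≔ .succ bound

/-- Visit the best resource and continue from its previous owner. -/
def advance : Program :=
  store label best bound ;; store prev (load owner best) best ;; exchange

/-- Report that the copy at the root cannot be matched. -/
def giveUp : Program :=
  failed ≔ .const 1 ;; cur ≔ .const 0

/-- Return to the copy from which the search came. -/
def retreat : Program :=
  best ≔ load prev cur ;; exchange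

/-- One step of the depth-first search for an augmenting path. -/
def searchStep : Program :=
  scan ;; .ite (.lt best resources) advance (.ite (.eq cur root) giveUp retreat)

/-- Search an augmenting path from the current copy; the visited resources are those with label
`bound`. -/
def search : Program :=
  .loop (.neg (.eq cur (.const 0))) searchStep

/-- Search augmenting paths from all waiting copies, until one of the searches fails. -/
def augment : Program :=
  failed ≔ .const 0 ;;
  .loop (.conj (.lt (.const 0) numWaiting) (.eq failed (.const 0))) (beginSearch ;; search)

/-- The state between two searches: the copies that are not waiting are matched, unless `failed` is
set because the copies cannot all be matched. -/
structure AugmentInv (s : State) : Prop where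
  label_le : ∀ r < s.reg resources, s.tab label r ≤ s.reg bound
  result : (s.reg failed = 0 ∧ IsPartial (Likes s) (Finset.Icc 1 (s.reg copies))
      (Finset.range (s.reg resources)) (s.tab owner) s.waitingList 0) ∨
    (s.reg failed ≠ 0 ∧ ¬ Saturable (Likes s) (Finset.Icc 1 (s.reg copies))
      (Finset.range (s.reg resources)))

/-- The set of resources visited by the current search. -/
def State.visited (s : State) : Finset ℕ :=
  superlevel (Finset.range (s.reg resources)) (s.tab label) (s.reg bound)

/-- A search is in progress and ends after fewer than `k` further steps: every resource is
visited at most once and left at most once. -/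
structure Searching (k : ℕ) (s : State) : Prop where
  cur_ne : s.reg cur ≠ 0
  failed_eq : s.reg failed = 0
  label_le : ∀ r < s.reg resources, s.tab label r ≤ s.reg bound
  search : ∃ S, IsSearch (Likes s) (Finset.Icc 1 (s.reg copies)) (Finset.range (s.reg resources))
      (s.tab owner) (s.tab prev) s.visited s.waitingList (s.reg cur) (s.reg root) S ∧
    2 * s.reg resources + S.length < k + 2 * s.visited.card

/-- A search has ended or is in progress. -/
def SearchInv (k : ℕ) (s : State) : Prop :=
  (s.reg cur = 0 ∧ AugmentInv s) ∨ Searching k s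

theorem Searching.pos {k : ℕ} {s : State} (h : Searching k s) : 0 < k := by
  obtain ⟨S, hS, hk⟩ := h.search
  have := Finset.card_le_card hS.visited_subset
  rw [Finset.card_range] at this
  omega

theorem Searching.of_frame_scan {k : ℕ} {s s' : State} (h : Searching k s)
    (hF : scan.Frame s s') : Searching k s' := by
  obtain ⟨hcur, hfailed, hle, hS⟩ := h
  refine ⟨?_, ?_, ?_, ?_⟩
  · rwa [hF.reg_eq cur]
  · rwa [hF.reg_eq failed]
  · rwa [hF.reg_eq resources, hF.tab_eq label, hF.reg_eq bound]
  · rwa [State.visited, hF.likes_eq, hF.reg_eq copies, hF.reg_eq resources, hF.tab_eq owner,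
      hF.tab_eq prev, hF.tab_eq label, hF.reg_eq bound, hF.waitingList_eq, hF.reg_eq cur,
      hF.reg_eq root]

theorem beginSearch_spec {s : State} (h : AugmentInv s) (hwait : 0 < s.reg numWaiting)
    (hfailed : s.reg failed = 0) :
    Yields beginSearch s fun s' c => c ≤ 20 ∧ s'.reg numWaiting < s.reg numWaiting ∧
      Searching (2 * s.reg resources + 1) s' := by
  have effect : Yields beginSearch s fun s' c => c ≤ 20 ∧
      s'.reg numWaiting = s.reg numWaiting - 1 ∧
      s'.reg cur = s.tab waiting (s.reg numWaiting - 1) ∧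
      s'.reg root = s.tab waiting (s.reg numWaiting - 1) ∧ s'.reg bound = s.reg bound + 1 := by
    simp [beginSearch, yields_seq, yields_assign, Expr.eval, Expr.cost, eval_load, cost_load,
      reg_setReg, tab_setReg]
  refine effect.imp fun s' c hF ⟨hc, hnum', hcur', hroot', hbound'⟩ => ⟨hc, by omega, ?_⟩
  obtain ⟨hle, ⟨-, hM⟩ | ⟨hfailed', -⟩⟩ := h
  swap
  · exact absurd hfailed hfailed'
  have pop : s.waitingList = s'.waitingList ++ [s'.reg cur] := by
    rw [waitingList_eq_append (s := s') (by omega), hnum', hcur']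
    exact fun i _ => congrFun (hF.tab_eq waiting).symm i
  have visited_eq : s'.visited = ∅ := by
    rw [State.visited, hF.reg_eq resources, hF.tab_eq label, hbound']
    exact superlevel_eq_empty fun r hr => Nat.lt_succ_of_le (hle r (Finset.mem_range.1 hr))
  refine ⟨fun h0 => hM.zero_notMem ?_, ?_, ?_, [], ?_, ?_⟩
  · rw [pop, h0]
    exact List.mem_concat_self
  · rw [hF.reg_eq failed, hfailed]
  · rw [hF.reg_eq resources, hF.tab_eq label, hbound']
    exact fun r hr => (hle r hr).trans (Nat.le_succ _)
  · rw [visited_eq, hF.likes_eq, hF.reg_eq copies, hF.reg_eq resources, hF.tab_eq owner, hroot',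
      ← hcur']
    exact .start (pop ▸ hM).resume
  · rw [visited_eq, hF.reg_eq resources, List.length_nil, Finset.card_empty]
    omega

theorem advance_effect (s : State) :
    Yields advance s fun s' c => c ≤ 30 ∧
      s'.tab label = Function.update (s.tab label) (s.reg best) (s.reg bound) ∧
      s'.tab prev = Function.update (s.tab prev) (s.tab owner (s.reg best)) (s.reg best) ∧
      s'.tab owner = Function.update (s.tab owner) (s.reg best) (s.reg cur) ∧
      s'.reg cur = s.tab owner (s.reg best) := by
  simp only [advance, yields_seq, yields_store]
  refine (exchange_spec _).imp fun s' c hF ⟨hc, howner, hcur'⟩ => ⟨?_, ?_, ?_, ?_, ?_⟩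
  · simp only [Expr.cost, cost_load]
    omega
  · rw [hF.tab_eq label]
    simp [tab_setTab, Expr.eval]
  · rw [hF.tab_eq prev]
    simp [tab_setTab, reg_setTab, Expr.eval, eval_load]
  · simpa [tab_setTab, reg_setTab] using howner
  · simpa [tab_setTab, reg_setTab] using hcur'

theorem advance_spec {k : ℕ} {s : State} (h : Searching k s)
    (hbest : s.reg best < s.reg resources) (hlikes : Likes s (s.reg cur) (s.reg best))
    (hlt : s.tab label (s.reg best) < s.reg bound) :
    Yields advance s fun s' c => c ≤ 30 ∧ ∃ k' < k, SearchInv k' s' := by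
  have hmem : s.reg best ∈ Finset.range (s.reg resources) := Finset.mem_range.2 hbest
  have hk := h.pos
  obtain ⟨hcur, hfailed, hle, S, hS, hlen⟩ := h
  refine (advance_effect s).imp fun s' c hF ⟨hc, hlabel', hprev', howner', hcur'⟩ =>
    ⟨hc, k - 1, by omega, ?_⟩
  have hle' : ∀ r < s'.reg resources, s'.tab label r ≤ s'.reg bound := by
    rw [hF.reg_eq resources, hF.reg_eq bound, hlabel']
    grind [Function.update_apply]
  have notMem : s.reg best ∉ s.visited := fun hV => (mem_superlevel.1 hV).2.not_gt hlt
  have visited_eq : s'.visited = insert (s.reg best) s.visited := by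
    rw [State.visited, hF.reg_eq resources, hF.reg_eq bound, hlabel', superlevel_update hmem]
    rfl
  by_cases h0 : s.tab owner (s.reg best) = 0
  · refine .inl ⟨hcur'.trans h0, hle', .inl ⟨?_, ?_⟩⟩
    · rw [hF.reg_eq failed, hfailed]
    · rw [hF.likes_eq, hF.reg_eq copies, hF.reg_eq resources, howner', hF.waitingList_eq]
      exact hS.partial_of_free hcur hmem hlikes h0
  · refine .inr ⟨hcur' ▸ h0, ?_, hle', s.reg best :: S, ?_, ?_⟩
    · rw [hF.reg_eq failed, hfailed]
    · rw [visited_eq, hF.likes_eq, hF.reg_eq copies, hF.reg_eq resources, howner', hprev',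
        hF.waitingList_eq, hF.reg_eq root, hcur']
      exact hS.forward hcur hmem notMem hlikes h0
    · rw [visited_eq, hF.reg_eq resources, Finset.card_insert_of_notMem notMem, List.length_cons]
      omega

theorem giveUp_spec {k : ℕ} {s : State} (h : Searching k s) (hroot : s.reg cur = s.reg root)
    (hV : ∀ r < s.reg resources, Likes s (s.reg cur) r → r ∈ s.visited) :
    Yields giveUp s fun s' c => c ≤ 30 ∧ ∃ k' < k, SearchInv k' s' := by
  have effect : Yields giveUp s fun s' c => c ≤ 30 ∧ s'.reg failed = 1 ∧ s'.reg cur = 0 := by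
    simp [giveUp, yields_seq, yields_assign, Expr.eval, Expr.cost, reg_setReg]
  have hk := h.pos
  obtain ⟨hcur, hfailed, hle, S, hS, hlen⟩ := h
  refine effect.imp fun s' c hF ⟨hc, hfailed', hcur'⟩ =>
    ⟨hc, 0, hk, .inl ⟨hcur', ?_, .inr ⟨hfailed' ▸ one_ne_zero, ?_⟩⟩⟩
  · rwa [hF.reg_eq resources, hF.tab_eq label, hF.reg_eq bound]
  · rw [hroot] at hS hcur hV
    rw [hF.likes_eq, hF.reg_eq copies, hF.reg_eq resources]
    exact hS.not_saturable hcur fun r hr => hV r (Finset.mem_range.1 hr)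

theorem retreat_spec {k : ℕ} {s : State} (h : Searching k s) (hroot : s.reg cur ≠ s.reg root)
    (hV : ∀ r < s.reg resources, Likes s (s.reg cur) r → r ∈ s.visited) :
    Yields retreat s fun s' c => c ≤ 30 ∧ ∃ k' < k, SearchInv k' s' := by
  have effect : Yields retreat s fun s' c => c ≤ 30 ∧
      s'.tab owner = Function.update (s.tab owner) (s.tab prev (s.reg cur)) (s.reg cur) ∧
      s'.reg cur = s.tab owner (s.tab prev (s.reg cur)) := by
    rw [retreat, yields_seq, yields_assign]
    refine (exchange_spec _).imp fun s' c _ ⟨hc, howner, hcur'⟩ => ⟨?_, ?_, ?_⟩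
    · simp only [Expr.cost, cost_load]
      omega
    · simpa [tab_setReg, reg_setReg, Expr.eval, eval_load] using howner
    · simpa [tab_setReg, reg_setReg, Expr.eval, eval_load] using hcur'
  have hk := h.pos
  obtain ⟨hcur, hfailed, hle, S, hS, hlen⟩ := h
  obtain ⟨S', rfl, hS'⟩ := hS.backtrack hcur hroot fun r hr => hV r (Finset.mem_range.1 hr)
  refine effect.imp fun s' c hF ⟨hc, howner', hcur'⟩ => ⟨hc, k - 1, by omega, .inr ?_⟩
  have visited_eq : s'.visited = s.visited := by
    rw [State.visited, State.visited, hF.reg_eq resources, hF.tab_eq label, hF.reg_eq bound]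
  refine ⟨?_, ?_, ?_, S', ?_, ?_⟩
  · exact hcur' ▸ hS.own_ne_zero _ (hS.trail_subset _ List.mem_cons_self)
  · rw [hF.reg_eq failed, hfailed]
  · rwa [hF.reg_eq resources, hF.tab_eq label, hF.reg_eq bound]
  · rwa [visited_eq, hF.likes_eq, hF.reg_eq copies, hF.reg_eq resources, howner', hF.tab_eq prev,
      hF.waitingList_eq, hF.reg_eq root, hcur']
  · rw [List.length_cons] at hlen
    rw [visited_eq, hF.reg_eq resources]
    omega

theorem searchStep_spec {k : ℕ} {s : State} (h : Searching k s) :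
    Yields searchStep s fun s' c =>
      c ≤ 40 * s.reg resources + 60 ∧ ∃ k' < k, SearchInv k' s' := by
  rw [searchStep, yields_seq]
  refine (scan_spec s).imp fun s' c hF ⟨hc, hmin⟩ => ?_
  have h' := h.of_frame_scan hF
  simp only [yields_ite, Test.Holds, Test.cost, Expr.eval, Expr.cost]
  obtain ⟨hle, ⟨hbest, hlikes, hv, hlt⟩ | ⟨hbest, hv⟩⟩ := hmin
  · refine ⟨fun _ => ?_, fun hge => absurd hbest hge⟩
    exact (advance_spec h' hbest hlikes (hv ▸ hlt)).imp
      fun s'' d _ ⟨hd, h''⟩ => ⟨by omega, h''⟩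
  · have hV : ∀ r < s'.reg resources, Likes s' (s'.reg cur) r → r ∈ s'.visited := fun r hr hl =>
      mem_superlevel.2 ⟨Finset.mem_range.2 hr, hv ▸ hle r hr hl⟩
    refine ⟨fun hlt => absurd hbest hlt.ne, fun _ => ⟨fun hroot => ?_, fun hroot => ?_⟩⟩
    · exact (giveUp_spec h' hroot hV).imp fun s'' d _ ⟨hd, h''⟩ => ⟨by omega, h''⟩
    · exact (retreat_spec h' hroot hV).imp fun s'' d _ ⟨hd, h''⟩ => ⟨by omega, h''⟩

theorem search_spec {k : ℕ} {s : State} (h : Searching k s) :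
    Yields search s fun s' c => c ≤ k * (40 * s.reg resources + 65) + 5 ∧ AugmentInv s' := by
  refine (yields_loop SearchInv (40 * s.reg resources + 60) (.inr h) ?_).imp ?_
  · rintro k' s' hF (⟨hcur, -⟩ | h') hrun
    · exact absurd hcur hrun
    · rw [← hF.reg_eq resources]
      exact searchStep_spec h'
  · rintro s' c - ⟨hc, hdone, k', ⟨-, h'⟩ | h'⟩
    · exact ⟨hc, h'⟩
    · exact absurd h'.cur_ne hdone

theorem augment_spec {s : State} (hle : ∀ r < s.reg resources, s.tab label r ≤ s.reg bound)
    (hM : IsPartial (Likes s) (Finset.Icc 1 (s.reg copies)) (Finset.range (s.reg resources))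
      (s.tab owner) s.waitingList 0) :
    Yields augment s fun s' c =>
      c ≤ s.reg numWaiting * ((2 * s.reg resources + 1) * (40 * s.reg resources + 65) + 33) + 10 ∧
      (s'.reg failed = 0 ↔ Saturable (Likes s') (Finset.Icc 1 (s'.reg copies))
        (Finset.range (s'.reg resources))) := by
  rw [augment, yields_seq, yields_assign]
  refine (yields_loop_of_measure AugmentInv (fun s => s.reg numWaiting)
    ((2 * s.reg resources + 1) * (40 * s.reg resources + 65) + 25) ?_ ?_).imp ?_
  · exact ⟨hle, .inl ⟨rfl, hM⟩⟩
  · rintro s' hF h ⟨hwait, hfailed⟩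
    have hm : s'.reg resources = s.reg resources := hF.reg_eq resources
    rw [yields_seq]
    refine (beginSearch_spec h hwait hfailed).imp fun s₁ c hF₁ ⟨hc, hlt, h₁⟩ => ?_
    refine (search_spec h₁).imp fun s₂ d hF₂ ⟨hd, h₂⟩ => ⟨?_, h₂, ?_⟩
    · rw [hF₁.reg_eq resources, hm] at hd
      omega
    · rwa [hF₂.reg_eq numWaiting]
  · rintro s' c - ⟨hc, hdone, -, hinv⟩
    simp only [Test.cost, Expr.cost, reg_setReg, reduceCtorEq, if_false, Nat.add_assoc,
      Nat.reduceAdd] at hc ⊢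
    refine ⟨by omega, ?_⟩
    obtain ⟨hfailed, hM⟩ | ⟨hfailed, hM⟩ := hinv
    · have hempty : s'.waitingList = [] := by
        have : s'.reg numWaiting = 0 := Nat.eq_zero_of_not_pos fun hwait => hdone ⟨hwait, hfailed⟩
        rw [State.waitingList, this, List.range_zero, List.map_nil]
      exact iff_of_true hfailed (hempty ▸ hM).saturable
    · exact iff_of_false hfailed hM

/-- The machine has answered the question `Q`. -/
def State.Answers (s : State) (Q : Prop) : Prop :=
  (Q ∧ s.reg agents = 1) ∨ (¬ Q ∧ s.reg agents = 0)

/-- Store the answer `k` in the result register. -/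
def answer (k : ℕ) : Program :=
  agents ≔ .const k

theorem yields_answer {k : ℕ} {s : State} {Q : State → ℕ → Prop} :
    Yields (answer k) s Q ↔ Q (s.setReg agents k) 2 :=
  yields_assign

theorem answers_one (s : State) {Q : Prop} (h : Q) : (s.setReg agents 1).Answers Q :=
  .inl ⟨h, rfl⟩

theorem answers_zero (s : State) {Q : Prop} (h : ¬ Q) : (s.setReg agents 0).Answers Q :=
  .inr ⟨h, rfl⟩

/-- Decide whether the listed copies can all be matched, given the price cap. More than `cap` copies
can withdraw from the auction only if they cannot. -/
def matchWithCap : Program :=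
  auction ;;
  .ite (.lt cap numWaiting) (answer 0)
    (augment ;; .ite (.eq failed (.const 0)) (answer 1) (answer 0))

/-- Decide whether the listed copies can all be matched. -/
def matchCopies : Program :=
  computeCap ;; matchWithCap

/-- Decide whether there is an envy-free allocation of egalitarian welfare at least `threshold`. -/
def decideESW : Program :=
  .ite (.eq threshold (.const 0)) (answer 1)
    (listCopies ;; .ite (.lt resources copies) (answer 0) (matchCopies))

theorem length_waitingList (s : State) : s.waitingList.length = s.reg numWaiting := by
  rw [State.waitingList, List.length_map, List.length_range]

theorem auction_cost_le {m K N : ℕ} (hm : 1 ≤ m) (hK : 1 ≤ K) (hN : N ≤ m) :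
    (m * K + 2 * N) * (40 * m + 69) + 30 ≤ 357 * (m * m * K) :=
  have hmK : m ≤ m * K := Nat.le_mul_of_pos_right m hK
  have hpos : 1 ≤ m * m * K := Nat.mul_pos (Nat.mul_pos hm hm) hK
  calc (m * K + 2 * N) * (40 * m + 69) + 30
    _ ≤ (3 * (m * K)) * (109 * m) + 30 * (m * m * K) :=
      Nat.add_le_add (Nat.mul_le_mul (by omega) (by omega)) (by omega)
    _ = 357 * (m * m * K) := by ring

theorem augment_cost_le {m K g : ℕ} (hm : 1 ≤ m) (hK : 1 ≤ K) (hg : g ≤ K) :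
    g * ((2 * m + 1) * (40 * m + 65) + 33) + 10 ≤ 358 * (m * m * K) :=
  have hmm : 1 ≤ m * m := Nat.mul_pos hm hm
  have hpos : 1 ≤ m * m * K := Nat.mul_pos hmm hK
  calc g * ((2 * m + 1) * (40 * m + 65) + 33) + 10
    _ ≤ K * ((3 * m) * (105 * m) + 33 * (m * m)) + 10 * (m * m * K) := by
      gcongr <;> omega
    _ = 358 * (m * m * K) := by ring

theorem le_of_mul_le_of_le_triangle {m K g : ℕ} (hK : 1 ≤ K) (hm : 2 * m ≤ K * K + K)
    (hg : g * K ≤ m) : g ≤ K := by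
  by_contra! hlt
  have : (K + 1) * K ≤ g * K := Nat.mul_le_mul_right K hlt
  have : 1 ≤ K * K := Nat.mul_pos hK hK
  rw [Nat.add_mul] at *
  omega

theorem matchWithCap_spec {s : State} (howner : ∀ r < s.reg resources, s.tab owner r = 0)
    (hlabel : ∀ r < s.reg resources, s.tab label r = 0) (hpos : 1 ≤ s.reg copies)
    (hle : s.reg copies ≤ s.reg resources) (hcap : 1 ≤ s.reg cap)
    (htriangle : 2 * s.reg resources ≤ s.reg cap * s.reg cap + s.reg cap) :
    Yields matchWithCap s fun s' c =>
      c ≤ 730 * (s.reg resources * s.reg resources * s.reg cap) ∧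
      s'.Answers (Saturable (Likes s) (Finset.Icc 1 (s.reg copies))
        (Finset.range (s.reg resources))) := by
  have hm := hpos.trans hle
  have cost_pos : 1 ≤ s.reg resources * s.reg resources * s.reg cap :=
    Nat.mul_pos (Nat.mul_pos hm hm) hcap
  rw [matchWithCap, yields_seq]
  refine (auction_spec howner hlabel).imp fun s₁ c₁ hF₁ ⟨hc₁, hA, hbound⟩ => ?_
  replace hc₁ := hc₁.trans (auction_cost_le hm hcap hle)
  simp only [yields_ite, yields_seq, yields_answer, Test.Holds, Test.cost, Expr.eval, Expr.cost]
  rw [← hF₁.likes_eq, ← hF₁.reg_eq copies, ← hF₁.reg_eq resources, ← hF₁.reg_eq cap] at *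
  refine ⟨fun hmany => ⟨by omega, answers_zero _ fun hs => ?_⟩, fun hfew => ?_⟩
  · have := hA.length_mul_le hs
    rw [length_waitingList, Finset.card_range] at this
    exact (le_of_mul_le_of_le_triangle hcap htriangle this).not_gt hmany
  have label_le : ∀ r < s₁.reg resources, s₁.tab label r ≤ s₁.reg bound :=
    hbound ▸ fun r hr => hA.price_le r (Finset.mem_range.2 hr)
  refine (augment_spec label_le hA.toIsPartial).imp fun s₂ c₂ hF₂ ⟨hc₂, hiff⟩ => ?_
  replace hc₂ := hc₂.trans (augment_cost_le hm hcap (not_lt.1 hfew))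
  rw [hF₂.likes_eq, hF₂.reg_eq copies, hF₂.reg_eq resources] at hiff
  rw [← hiff]
  exact ⟨fun h => ⟨by omega, answers_one _ h⟩, fun h => ⟨by omega, answers_zero _ h⟩⟩

theorem matchCopies_spec {s : State} (howner : ∀ r < s.reg resources, s.tab owner r = 0)
    (hlabel : ∀ r < s.reg resources, s.tab label r = 0) (hpos : 1 ≤ s.reg copies)
    (hle : s.reg copies ≤ s.reg resources) :
    Yields matchCopies s fun s' c =>
      (∃ K, 1 ≤ K ∧ K * K ≤ 2 * s.reg resources + K ∧
        c ≤ 810 * (s.reg resources * s.reg resources * K)) ∧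
      s'.Answers (Saturable (Likes s) (Finset.Icc 1 (s.reg copies))
        (Finset.range (s.reg resources))) := by
  rw [matchCopies, yields_seq]
  refine (computeCap_spec s).imp fun s₁ c₁ hF₁ ⟨hc₁, hcap, htriangle, hsq⟩ => ?_
  rw [← hF₁.likes_eq, ← hF₁.reg_eq copies, ← hF₁.reg_eq resources, ← hF₁.tab_eq owner,
    ← hF₁.tab_eq label] at *
  refine (matchWithCap_spec howner hlabel hpos hle hcap htriangle).imp
    fun s₂ c₂ _ ⟨hc₂, hanswer⟩ => ⟨⟨s₁.reg cap, hcap, hsq, ?_⟩, hanswer⟩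
  have hm := hpos.trans hle
  have : s₁.reg resources ≤ s₁.reg resources * s₁.reg resources * s₁.reg cap :=
    (Nat.le_mul_of_pos_right _ hm).trans (Nat.le_mul_of_pos_right _ hcap)
  omega

theorem cast_le_rpow {M K c : ℕ} (hM : 1 ≤ M) (hK : K * K ≤ 2 * M + K)
    (hc : c ≤ 1000 * (M * M * K)) : (c : ℝ) ≤ 2000 * (M : ℝ) ^ (5 / 2 : ℝ) := by
  have hM' : (1 : ℝ) ≤ M := mod_cast hM
  have hK' : (K : ℝ) * K ≤ 2 * M + K := mod_cast hK
  have rpow_eq : (M : ℝ) ^ (5 / 2 : ℝ) = M * M * √M := by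
    rw [Real.sqrt_eq_rpow, show (5 / 2 : ℝ) = 1 + 1 + 1 / 2 by norm_num,
      Real.rpow_add (by linarith), Real.rpow_add (by linarith), Real.rpow_one]
  have K_le : (K : ℝ) ≤ 2 * √M := by
    have one_le : 1 ≤ √(M : ℝ) := Real.one_le_sqrt.2 hM'
    have sq_eq : √(M : ℝ) * √M = M := Real.mul_self_sqrt (by linarith)
    by_contra! hlt
    nlinarith
  calc (c : ℝ)
    _ ≤ 1000 * (M * M * K) := mod_cast hc
    _ ≤ 1000 * (M * M * (2 * √M)) := by gcongr
    _ = 2000 * (M : ℝ) ^ (5 / 2 : ℝ) := by rw [rpow_eq]; ring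

theorem cast_le_rpow_of_le {M c : ℕ} (hM : 1 ≤ M) (hc : c ≤ 1000 * M) :
    (c : ℝ) ≤ 2000 * (M : ℝ) ^ (5 / 2 : ℝ) :=
  cast_le_rpow hM (K := 1) (by omega) (by nlinarith)

open FairDivision

section Input

variable {n m t : ℕ} {u : Fin n → Fin m → ℕ}

theorem reg_input_agents : (input u t).reg agents = n :=
  rfl

theorem reg_input_resources : (input u t).reg resources = m :=
  rfl

theorem reg_input_threshold : (input u t).reg threshold = t :=
  rfl

theorem arr_input_utility (a : Fin n) (r : Fin m) : (input u t).arr utility a r = u a r :=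
  dif_pos ⟨rfl, a.2, r.2⟩

theorem tab_input {k : Table} (hk : k ≠ utility) (i : ℕ) : (input u t).tab k i = 0 :=
  dif_neg fun h => hk (Table.idx_inj.1 h.1)

theorem saturable_likes_iff {s : State} (hu : s.arr utility = (input u t).arr utility)
    (hagent : ∀ x ∈ Finset.Icc 1 (n * t), s.tab agentOf x = (x - 1) / t) :
    Saturable (Likes s) (Finset.Icc 1 (n * t)) (Finset.range m) ↔ HasCopyAssignment u t := by
  have likes_copy : ∀ (x : Fin n × Fin t) (r : Fin m),
      Likes s (finProdFinEquiv x + 1) r ↔ u x.1 r = 1 := by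
    rintro ⟨a, i⟩ r
    have mem : (finProdFinEquiv (a, i) + 1 : ℕ) ∈ Finset.Icc 1 (n * t) :=
      Finset.mem_Icc.2 ⟨Nat.le_add_left .., (finProdFinEquiv (a, i)).2⟩
    have agentOf_copy : s.tab agentOf (finProdFinEquiv (a, i) + 1) = a := by
      rw [hagent _ mem, Nat.add_sub_cancel, finProdFinEquiv_apply_val,
        Nat.add_mul_div_left _ _ i.pos, Nat.div_eq_of_lt i.2, Nat.zero_add]
    rw [Likes, agentOf_copy, hu, arr_input_utility]
  rw [saturable_Icc_range_iff, HasCopyAssignment]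
  constructor
  · rintro ⟨f, hf, hlikes⟩
    exact ⟨f ∘ finProdFinEquiv, hf.comp finProdFinEquiv.injective,
      fun x => (likes_copy x _).1 (hlikes _)⟩
  · rintro ⟨f, hf, hfu⟩
    refine ⟨f ∘ finProdFinEquiv.symm, hf.comp finProdFinEquiv.symm.injective, fun i => ?_⟩
    simpa only [Equiv.apply_symm_apply, Function.comp_apply] using
      (likes_copy (finProdFinEquiv.symm i) _).2 (hfu _)

theorem decideESW_spec [NeZero n] (t : ℕ) (u : Fin n → Fin m → ℕ) :
    Yields decideESW (input u t) fun s' c =>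
      (c : ℝ) ≤ 2000 * ((max 1 m : ℕ) : ℝ) ^ (5 / 2 : ℝ) ∧
        s'.Answers (HasCopyAssignment u t) := by
  have one_le : 1 ≤ max 1 m := le_max_left 1 m
  simp only [decideESW, yields_ite, yields_seq, yields_answer, Test.Holds, Test.cost, Expr.eval,
    Expr.cost, reg_input_threshold]
  refine ⟨?_, fun ht => ?_⟩
  · rintro rfl
    exact ⟨cast_le_rpow_of_le one_le (by omega), answers_one _ (hasCopyAssignment_zero u)⟩
  refine (listCopies_spec _ (Nat.pos_of_ne_zero ht)).imp fun s₁ c₁ hF₁ ⟨hc₁, hcopies, hagent⟩ => ?_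
  have hm : s₁.reg resources = m := hF₁.reg_eq resources
  rw [reg_input_agents, reg_input_resources, reg_input_threshold] at *
  refine ⟨fun hmany => ⟨cast_le_rpow_of_le one_le (by omega), answers_zero _ fun h => ?_⟩,
    fun hfew => ?_⟩
  · have := h.card_mul_le
    rw [Fintype.card_fin, Fintype.card_fin] at this
    omega
  have copies_eq : s₁.reg copies = n * t := by omega
  have copies_pos : 1 ≤ s₁.reg copies :=
    copies_eq ▸ Nat.mul_pos (Nat.pos_of_neZero n) (Nat.pos_of_ne_zero ht)
  have owner_eq : s₁.tab owner = 0 := (hF₁.tab_eq owner).trans (funext (tab_input nofun))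
  have label_eq : s₁.tab label = 0 := (hF₁.tab_eq label).trans (funext (tab_input nofun))
  refine (matchCopies_spec (fun r _ => congrFun owner_eq r) (fun r _ => congrFun label_eq r)
    copies_pos (not_lt.1 hfew)).imp fun s₂ c₂ _ ⟨⟨K, hK, hsq, hc₂⟩, hanswer⟩ => ?_
  rw [copies_eq, hm, saturable_likes_iff (hF₁.arr_eq utility) (copies_eq ▸ hagent)] at hanswer
  have hm_pos : 1 ≤ m := copies_pos.trans (hm ▸ not_lt.1 hfew)
  have hmK : m ≤ m * m * K :=
    (Nat.le_mul_of_pos_right _ hm_pos).trans (Nat.le_mul_of_pos_right _ hK)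
  rw [hm] at hsq hc₂
  rw [max_eq_right hm_pos]
  exact ⟨cast_le_rpow hm_pos hsq (by omega), hanswer⟩

theorem decides_decideESW [NeZero n] (hu : IsBinary u) :
    Decides decideESW (input u t) (2000 * max 1 (m : ℝ) ^ (5 / 2 : ℝ)) (HasEnvyFreeESW u t) := by
  obtain ⟨s, c, hexec, hc, hanswer⟩ := decideESW_spec t u
  rw [Nat.cast_max, Nat.cast_one] at hc
  rw [← hasEnvyFreeESW_iff_hasCopyAssignment hu] at hanswer
  exact ⟨s, c, hexec, hc, hanswer⟩

end Input

end RAM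

theorem theorem2_general :
    (∃ (p : RAM.Program) (C : ℝ), ∀ (n m t : ℕ) [NeZero n] (u : Fin n → Fin m → ℕ),
      FairDivision.IsBinary u →
        RAM.Decides p (RAM.input u t) (C * (max 1 (m : ℝ)) ^ (5 / 2 : ℝ))
          (FairDivision.HasEnvyFreeESW u t)) ∧
    (∀ (A R : Type*) [Fintype A] [Nonempty A] (t : ℕ) (u : A → R → ℕ), FairDivision.IsBinary u →
      (FairDivision.HasEnvyFreeESW u t ↔ FairDivision.HasAgentSaturatingMatching u t)) := by
  refine ⟨⟨RAM.decideESW, 2000, fun n m t _ u hu => RAM.decides_decideESW hu⟩,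
    fun A R _ _ t u hu => ?_⟩
  rw [FairDivision.hasEnvyFreeESW_iff_hasCopyAssignment hu,
    FairDivision.hasAgentSaturatingMatching_iff_hasCopyAssignment]

theorem theorem2 :
    (∃ (p : RAM.Program) (C : ℝ), ∀ (n m t : ℕ) [NeZero n] (u : Fin n → Fin m → ℕ),
      FairDivision.IsBinary u →
        RAM.Decides p (RAM.input u t) (C * (max 1 (m : ℝ)) ^ (5 / 2 : ℝ))
          (FairDivision.HasEnvyFreeESW u t)) ∧
    (∀ (n m t : ℕ) [NeZero n] (u : Fin n → Fin m → ℕ), FairDivision.IsBinary u →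
      (FairDivision.HasEnvyFreeESW u t ↔ FairDivision.HasAgentSaturatingMatching u t)) :=
  ⟨theorem2_general.{0, 0}.1, fun n m t _ u hu => theorem2_general.2 (Fin n) (Fin m) t u hu⟩
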